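/- **Setting.** A *semi-Markovian causal model* over a finite set $\mathbf V$ of observed variables, each with a finite non-empty domain, consists of finitely many mutually independent unobserved random variables $\mathbf U$ (with arbitrary domains and laws) and, for each $V_i\in\mathbf V$, a function $f_{V_i}$ that determines the value of $V_i$ and is defined in terms of a subset of $\mathbf V$ (its observed parents) and a subset of $\mathbf U$. Each $U\in\mathbf U$ appears in at most two of the functions, and the directed graph of observed parents is acyclic. The model *induces* the semi-Markovian graph (SMG) on $\mathbf V$ that has an edge $V_i\to V_j$ exactly when $f_{V_j}$ is defined in terms of $V_i$, and an edge $V_i\leftrightarrow V_j$ ($i\ne j$) exactly when $f_{V_i}$ and $f_{V_j}$ share an unobserved variable. $P_{\mathbf x}(\mathbf y)$ denotes the distribution of $\mathbf Y$ in the sub-model in which the functions of the variables in $\mathbf X$ are replaced with the constants $\mathbf x$. For an SMG $G$ on $\mathbf V$ and disjoint $\mathbf X,\mathbf Y\subseteq\mathbf O\subseteq\mathbf V$, the causal effect of $\mathbf X$ on $\mathbf Y$ is *identifiable from $P(\mathbf O)$ in $G$* if any two semi-Markovian causal models that induce $G$, have the same domains, and have the same distribution $P(\mathbf o)$ of $\mathbf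 O$, with $P(\mathbf o)>0$ for all $\mathbf o$, have the same $P_{\mathbf x}(\mathbf y)$ for all $\mathbf x$, $\mathbf y$. For an SMG $G$ on $\mathbf V$ and $\mathbf Z\subseteq\mathbf V$, replace each bidirected edge $A\leftrightarrow B$ of $G$ by a new vertex $U$ with edges $A\leftarrow U\to B$, and call the vertices in $\mathbf Z$ and the new vertices latent. The *latent projection* $L(G,\mathbf V\setminus\mathbf Z)$ is the SMG on $\mathbf V\setminus\mathbf Z$ such that, for distinct $A,B\in\mathbf V\setminus\mathbf Z$: it has the edge $A\to B$ exactly when there is a directed path from $A$ to $B$ on which every vertex other than $A$ and $B$ is latent; and it has the edge $A\leftrightarrow B$ exactly when there is a path between $A$ and $B$ without colliders $I\to M\leftarrow J$, on which every vertex other than $A$ and $B$ is latent, and whose first and last edges point into $A$ and into $B$. **Lemma.** Let $G$ be an SMG on $\mathbf V$ and let $\mathbf X,\mathbf Y,\mathbf Z\subseteq\mathbf V$ be pairwise disjoint. Put $P'=P(\mathbf V\setminus\mathbf Z)$. Then the causal effect of $\mathbf X$ on $\mathbf Y$ is identifiable from $P'$ in the latent projection $L(G,\mathbf V\setminus\mathbf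 Z)$ if and only if it is identifiable from $P'$ in $G$. -/

import Mathlib

open MeasureTheory
open scoped ENNReal

/-- A directed acyclic graph on the vertex type `W`. -/
structure DAG (W : Type) where
  /-- `edge a b` says that there is an edge `a → b`. -/
  edge : W → W → Prop
  acyclic : ∀ a, ¬ Relation.TransGen edge a a

/-- A semi-Markovian graph on the vertex type `V`: directed edges, which form a DAG, and
bidirected edges between pairs of distinct vertices. -/
structure SMG (V : Type) extends DAG V where
  /-- `bidirected.Adj a b` says that there is an edge `a ↔ b`. -/
  bidirected : SimpleGraph V

namespace DAG

variable {W : Type}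

/-- The list `p` is a directed path with at least one edge from `a` to `b`, on which every vertex
other than `a` and `b` is latent, that is, outside the set `O` of observed vertices. -/
def IsDirectedLatentPath (G : DAG W) (O : Set W) (a b : W) (p : List W) : Prop :=
  p.head? = some a ∧ p.getLast? = some b ∧ p.IsChain G.edge ∧
    ∀ m ∈ p, m ≠ a → m ≠ b → m ∉ O

/-- The list `p` contains a collider `i → m ← j`. -/
def HasCollider (G : DAG W) (p : List W) : Prop :=
  ∃ i m j, [i, m, j] <:+: p ∧ G.edge i m ∧ G.edge j m

/-- The list `p` is a path (edges may be traversed in both directions, vertices do not repeat)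
from `a` to `b` without colliders, whose first edge points into `a` and whose last edge points
into `b`, and on which every vertex other than `a` and `b` is outside the set `O` of observed
vertices. -/
def IsConfoundingPath (G : DAG W) (O : Set W) (a b : W) (p : List W) : Prop :=
  p.Nodup ∧ p.IsChain (fun i j => G.edge i j ∨ G.edge j i) ∧
    (∃ m, [a, m] <+: p ∧ G.edge m a) ∧ (∃ m, [m, b] <:+ p ∧ G.edge m b) ∧
    ¬ G.HasCollider p ∧ ∀ m ∈ p, m ≠ a → m ≠ b → m ∉ O

/-- The directed edges of the latent projection of `G` on the set `O` of observed vertices. -/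
def ProjDirected (G : DAG W) (O : Set W) (a b : W) : Prop :=
  a ≠ b ∧ ∃ p, G.IsDirectedLatentPath O a b p

/-- The bidirected edges of the latent projection of `G` on the set `O` of observed vertices. -/
def ProjBidirected (G : DAG W) (O : Set W) (a b : W) : Prop :=
  a ≠ b ∧ ∃ p, G.IsConfoundingPath O a b p

theorem ProjDirected.transGen {G : DAG W} {O : Set W} {a b : W} (h : G.ProjDirected O a b) :
    Relation.TransGen G.edge a b := by
  obtain ⟨hab, p, h1, h2, h3, -⟩ := h
  cases p with
  | nil => simp at h1
  | cons c l =>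
    obtain rfl : c = a := by simpa using h1
    have hr : Relation.ReflTransGen G.edge c b := by
      have := List.relationReflTransGen_of_exists_isChain_cons l h3
        (b := b) (by simpa [List.getLast?_eq_some_getLast] using h2)
      exact this
    rcases Relation.reflTransGen_iff_eq_or_transGen.1 hr with h | h
    · exact absurd h.symm hab
    · exact h

theorem ProjBidirected.symm {G : DAG W} {O : Set W} {a b : W} (h : G.ProjBidirected O a b) :
    G.ProjBidirected O b a := by
  obtain ⟨hab, p, h1, h2, ⟨m, hm, hm'⟩, ⟨n, hn, hn'⟩, h5, h6⟩ := h
  refine ⟨hab.symm, p.reverse, by simpa using h1, ?_, ⟨n, ?_, hn'⟩, ⟨m, ?_, hm'⟩, ?_, ?_⟩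
  · rw [List.isChain_reverse]
    exact h2.imp fun _ _ h => h.symm
  · simpa using List.reverse_prefix.2 hn
  · simpa using List.reverse_suffix.2 hm
  · rintro ⟨i, k, j, hi, h7, h8⟩
    refine h5 ⟨j, k, i, ?_, h8, h7⟩
    have := List.reverse_infix.2 hi
    simpa using this
  · intro k hk hb ha
    exact h6 k (by simpa using hk) ha hb

end DAG

namespace SMG

variable {V : Type}

/-- The DAG that the semi-Markovian graph `G` abbreviates: each bidirected edge `a ↔ b` stands for
an unobserved vertex `u` with the two edges `a ← u → b`. -/
def toExplicitDAG (G : SMG V) : DAG (V ⊕ G.bidirected.edgeSet) where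
  edge s t := match s, t with
    | .inl a, .inl b => G.edge a b
    | .inr e, .inl b => b ∈ (e : Sym2 V)
    | _, .inr _ => False
  acyclic := by
    have key : ∀ s t : V ⊕ G.bidirected.edgeSet, Relation.TransGen (fun s t =>
        match s, t with
        | .inl a, .inl b => G.edge a b
        | .inr e, .inl b => b ∈ (e : Sym2 V)
        | _, .inr _ => False) s t →
        ∃ b, t = .inl b ∧ ∀ a, s = .inl a → Relation.TransGen G.edge a b := by
      intro s t h
      induction h with
      | @single t h =>
        rcases s with a | e <;> rcases t with b | e' <;> simp at h ⊢
        exact .single h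
      | @tail t t' _ h ih =>
        obtain ⟨b, rfl, hb⟩ := ih
        rcases t' with c | e'
        · exact ⟨c, rfl, fun a ha => (hb a ha).tail h⟩
        · exact h.elim
    intro s h
    obtain ⟨b, rfl, hb⟩ := key s s h
    exact G.acyclic b (hb b rfl)

/-- The latent projection `L(G, V ∖ Z)` of a semi-Markovian graph: the vertices in `V ∖ Z` are
observed; the vertices in `Z`, and those that the bidirected edges stand for, are latent. -/
def latentProjection (G : SMG V) (Z : Set V) : SMG {v : V // v ∉ Z} where
  edge a b := G.toExplicitDAG.ProjDirected (Sum.inl '' Zᶜ) (.inl a.1) (.inl b.1)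
  acyclic a h := by
    have key : ∀ a b : {v : V // v ∉ Z}, Relation.TransGen (fun a b : {v : V // v ∉ Z} =>
        G.toExplicitDAG.ProjDirected (Sum.inl '' Zᶜ) (.inl a.1) (.inl b.1)) a b →
        Relation.TransGen G.toExplicitDAG.edge (.inl a.1) (.inl b.1) := by
      intro a b h
      induction h with
      | single h => exact h.transGen
      | tail _ h ih => exact ih.trans h.transGen
    exact G.toExplicitDAG.acyclic _ (key a a h)
  bidirected :=
    { Adj := fun a b => G.toExplicitDAG.ProjBidirected (Sum.inl '' Zᶜ) (.inl a.1) (.inl b.1)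
      symm := ⟨fun _ _ h => h.symm⟩
      loopless := ⟨fun _ h => h.1 rfl⟩ }

end SMG

/-- A semi-Markovian causal model with observed (endogenous) variables `V`, where `v` takes values
in `D v`. -/
structure CausalModel (V : Type) (D : V → Type) where
  /-- The unobserved (exogenous) variables. -/
  U : Type
  [fintypeU : Fintype U]
  /-- The domains of the unobserved variables. -/
  Ω : U → Type
  [measurableSpaceΩ : ∀ e, MeasurableSpace (Ω e)]
  /-- The distributions of the unobserved variables. These variables are mutually independent, so
  that their joint distribution is the product `Measure.pi law`. -/
  law : ∀ e, Measure (Ω e)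
  [isProbabilityMeasure_law : ∀ e, IsProbabilityMeasure (law e)]
  /-- The observed variables in terms of which the function of `v` is defined. -/
  paV : V → Set V
  /-- The unobserved variables in terms of which the function of `v` is defined. -/
  paU : V → Set U
  /-- The function that determines the value of `v`. -/
  f : ∀ v, (∀ w, D w) → (∀ e, Ω e) → D v
  f_congr : ∀ v a a' u u', (∀ w ∈ paV v, a w = a' w) → (∀ e ∈ paU v, u e = u' e) →
    f v a u = f v a' u'
  measurable_f : ∀ v a, Measurable[MeasurableSpace.pi, ⊤] (f v a)
  acyclic : ∀ v, ¬ Relation.TransGen (fun a b => a ∈ paV b) v v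
  /-- Each unobserved variable appears in at most two of the functions. -/
  card_children : ∀ e, {v | e ∈ paU v}.encard ≤ 2

namespace CausalModel

attribute [instance] fintypeU measurableSpaceΩ isProbabilityMeasure_law

variable {V : Type} {D : V → Type}

/-- The model `M` induces the semi-Markovian graph `G`: the directed edges are the pairs `a → b`
for which the function of `b` is defined in terms of `a`, and the bidirected edges are the pairs of
distinct variables whose functions share an unobserved variable. -/
def Induces (M : CausalModel V D) (G : SMG V) : Prop :=
  (∀ a b, G.edge a b ↔ a ∈ M.paV b) ∧
    ∀ a b, G.bidirected.Adj a b ↔ a ≠ b ∧ ∃ e, e ∈ M.paU a ∧ e ∈ M.paU b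

/-- The functions of a model form a mapping from the unobserved to the observed variables. -/
theorem existsUnique_solution [Finite V] [∀ v, Nonempty (D v)] (M : CausalModel V D)
    (u : ∀ e, M.Ω e) : ∃! a : ∀ v, D v, ∀ v, a v = M.f v a u := by
  classical
  have wf : WellFounded (fun a b => a ∈ M.paV b) := by
    have : Std.Irrefl (Relation.TransGen (fun a b => a ∈ M.paV b)) := ⟨M.acyclic⟩
    have wf' := Finite.wellFounded_of_trans_of_irrefl
      (Relation.TransGen (fun a b => a ∈ M.paV b))
    exact Subrelation.wf (r := Relation.TransGen (fun a b => a ∈ M.paV b))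
      (fun {_ _} h => Relation.TransGen.single h) wf'
  let F : ∀ v, (∀ w, w ∈ M.paV v → D w) → D v := fun v r =>
    M.f v (fun w => if h : w ∈ M.paV v then r w h else Classical.arbitrary _) u
  refine ⟨wf.fix F, fun v => ?_, fun b hb => ?_⟩
  · conv_lhs => rw [wf.fix_eq]
    exact M.f_congr _ _ _ _ _ (fun w hw => by simp [hw]) (fun _ _ => rfl)
  · funext v
    induction v using wf.induction with
    | _ v ih =>
      rw [hb v, wf.fix_eq]
      exact M.f_congr _ _ _ _ _ (fun w hw => by simp [hw, ih w hw]) (fun _ _ => rfl)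

/-- The values of the observed variables that result from the values `u` of the unobserved ones. -/
noncomputable def solution [Finite V] [∀ v, Nonempty (D v)] (M : CausalModel V D)
    (u : ∀ e, M.Ω e) : ∀ v, D v :=
  (M.existsUnique_solution u).choose

/-- The probability `P(s)` that the variables in `S` take the values prescribed by `s`
(only the values of `s` on `S` matter). -/
noncomputable def prob [Finite V] [∀ v, Nonempty (D v)] (M : CausalModel V D)
    (S : Set V) (s : ∀ v, D v) : ℝ≥0∞ :=
  Measure.pi M.law {u | ∀ v ∈ S, M.solution u v = s v}

open Classical in
/-- The sub-model `M_x` that results from the intervention `do(X = x)`: the functions that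
determine the variables in `X` are replaced with constants (only the values of `x` on `X`
matter). -/
noncomputable def intervene (M : CausalModel V D) (X : Set V) (x : ∀ v, D v) :
    CausalModel V D where
  U := M.U
  Ω := M.Ω
  law := M.law
  paV v := {w | v ∉ X ∧ w ∈ M.paV v}
  paU v := {e | v ∉ X ∧ e ∈ M.paU v}
  f v a u := if v ∈ X then x v else M.f v a u
  f_congr v a a' u u' ha hu := by
    by_cases hv : v ∈ X
    · simp [hv]
    · simp only [hv, if_false]
      exact M.f_congr v a a' u u' (fun w hw => ha w ⟨hv, hw⟩) (fun e he => hu e ⟨hv, he⟩)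
  measurable_f v a := by
    by_cases hv : v ∈ X
    · simp only [hv, if_true]
      exact @measurable_const _ _ ⊤ _ _
    · simp only [hv, if_false]
      exact M.measurable_f v a
  acyclic v h := M.acyclic v (Relation.TransGen.mono (fun _ _ hab => hab.2) _ _ h)
  card_children e := (Set.encard_le_encard fun _ hv => hv.2).trans (M.card_children e)

/-- The causal effect `P_x(y)` of `X` on `Y`. -/
noncomputable def causalEffect [Finite V] [∀ v, Nonempty (D v)] (M : CausalModel V D)
    (X : Set V) (x : ∀ v, D v) (Y : Set V) (y : ∀ v, D v) : ℝ≥0∞ :=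
  (M.intervene X x).prob Y y

end CausalModel

/-- The causal effect of `X` on `Y` is identifiable from the joint distribution `P(O)` of the
variables in `O` in the graph `G`: any two causal models that induce `G` and have the same positive
distribution of `O` have the same interventional distributions `P_x(y)`. -/
def SMG.Identifiable {V : Type} [Finite V] (G : SMG V) (O X Y : Set V) : Prop :=
  ∀ (D : V → Type) [∀ v, Finite (D v)] [∀ v, Nonempty (D v)] (M₁ M₂ : CausalModel V D),
    M₁.Induces G → M₂.Induces G →
    (∀ o, M₁.prob O o = M₂.prob O o) → (∀ o, 0 < M₁.prob O o) →
    ∀ x y, M₁.causalEffect X x Y y = M₂.causalEffect X x Y y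

/-! Write H for the latent projection. Both identifiability statements are shown to be equivalent to
one graphical condition, the absence of a `Hedge` in H. A direct transfer of models fails in both
directions. Substituting out the variables in Z can leave an unobserved variable with more than two
children, and a variable in Z with a finite domain cannot transmit unobserved values from an
infinite domain.

No hedge implies both identifiabilities. The argument uses `LatentModel`, which drops the bound of
two on the children of an unobserved variable, so that it covers models of H and, by
`CausalModel.project`, models of G. The factor Q(C)(o) is the probability that the functions of C
return o when their parents are held at o. Two operations preserve equality of factors between two
models: summing out a vertex without children in the set, and splitting the set where no bidirected
edge crosses (`Q_eq_of_union`). Where both fail to shrink a set down to a bidirected component of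
the ancestors of Y, the stuck set is a hedge (`Q_eq_of_isEmpty_hedge`).

A hedge refutes both identifiabilities. Two parity models on H have the same positive observed
distribution because two linear maps over `ZMod 2` have fibres of equal size
(`card_fiber_boundary_eq`), yet only in one of them does the intervention reach the parity of Y.
Their unobserved domains are finite, so `exists_lift` simulates them in G: each vertex of Z passes
on all the values that it receives. -/

namespace DAG

/-! ### Latent ancestors in a DAG and the edges of its projection -/

variable {W : Type}

/-- There is a directed path, possibly without edges, from `w` to `b`, on which every vertex other
than `b` is outside the set `O` of observed vertices. -/
def LatentAnc (K : DAG W) (O : Set W) : W → W → Prop :=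
  Relation.ReflTransGen fun x y => x ∉ O ∧ K.edge x y

theorem LatentAnc.reflTransGen {K : DAG W} {O : Set W} {w b : W} (h : K.LatentAnc O w b) :
    Relation.ReflTransGen K.edge w b :=
  Relation.ReflTransGen.mono (fun _ _ h => h.2) _ _ h

theorem LatentAnc.eq_of_mem {K : DAG W} {O : Set W} {w b : W} (h : K.LatentAnc O w b)
    (hw : w ∈ O) : w = b := by
  rcases Relation.ReflTransGen.cases_head h with h | ⟨c, hc, -⟩
  · exact h
  · exact absurd hw hc.1

theorem not_edge_of_reflTransGen {K : DAG W} {a b : W} (h : Relation.ReflTransGen K.edge a b) :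
    ¬ K.edge b a := fun hba => K.acyclic a (Relation.TransGen.tail' h hba)

theorem wellFounded_edge [Finite W] (K : DAG W) : WellFounded K.edge := by
  have : Std.Irrefl (Relation.TransGen K.edge) := ⟨K.acyclic⟩
  exact Subrelation.wf (fun {_ _} h => Relation.TransGen.single h)
    (Finite.wellFounded_of_trans_of_irrefl (Relation.TransGen K.edge))

theorem wellFounded_swap_transGen [Finite W] (K : DAG W) :
    WellFounded (Function.swap (Relation.TransGen K.edge)) := by
  have : Std.Irrefl (Function.swap (Relation.TransGen K.edge)) := ⟨K.acyclic⟩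
  have : IsTrans W (Function.swap (Relation.TransGen K.edge)) := ⟨fun _ _ _ h h' => h'.trans h⟩
  exact Finite.wellFounded_of_trans_of_irrefl _

theorem reflTransGen_of_isChain {K : DAG W} {a b : W} {l : List W}
    (h : (a :: l).IsChain K.edge) (hb : (a :: l).getLast? = some b) :
    Relation.ReflTransGen K.edge a b :=
  List.relationReflTransGen_of_exists_isChain_cons l h
    (by simpa [List.getLast?_eq_some_getLast] using hb)

/-- The path condition exempts every occurrence of `a` and `b` from being latent. By acyclicity the
exemption is void before the last vertex: such a vertex lies strictly after `a` and strictly before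
`b`. -/
theorem latentAnc_of_isChain {K : DAG W} {O : Set W} {a b : W} (l : List W) :
    ∀ c, (c :: l).IsChain K.edge → (c :: l).getLast? = some b →
      (∀ m ∈ c :: l, m ≠ a → m ≠ b → m ∉ O) → Relation.TransGen K.edge a c →
      K.LatentAnc O c b := by
  induction l with
  | nil =>
    intro c _ hb _ _
    obtain rfl : c = b := by simpa using hb
    exact .refl
  | cons d l ih =>
    intro c hc hb hO hac
    have hcd : K.edge c d := by simp at hc; exact hc.1
    have hd : (d :: l).IsChain K.edge := by simp at hc; exact hc.2
    have hb' : (d :: l).getLast? = some b := by simpa using hb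
    have hdb := reflTransGen_of_isChain hd hb'
    refine .head ⟨hO c (by simp) ?_ ?_, hcd⟩
      (ih d hd hb' (fun m hm => hO m (List.mem_cons_of_mem _ hm)) (hac.tail hcd))
    · rintro rfl; exact K.acyclic _ hac
    · rintro rfl; exact not_edge_of_reflTransGen hdb hcd

theorem projDirected_iff {K : DAG W} {O : Set W} {a b : W} :
    K.ProjDirected O a b ↔ a ≠ b ∧ ∃ w, K.edge a w ∧ K.LatentAnc O w b := by
  refine and_congr_right fun hab => ⟨?_, ?_⟩
  · rintro ⟨p, h1, h2, h3, h4⟩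
    rcases p with - | ⟨c, - | ⟨d, l⟩⟩
    · simp at h1
    · simp at h1 h2; exact absurd (h1.symm.trans h2) hab
    · obtain rfl : c = a := by simpa using h1
      have hcd : K.edge c d := by simp at h3; exact h3.1
      exact ⟨d, hcd, latentAnc_of_isChain l d (by simp at h3; exact h3.2) (by simpa using h2)
        (fun m hm => h4 m (List.mem_cons_of_mem _ hm)) (.single hcd)⟩
  · rintro ⟨w, haw, hwb⟩
    have : ∃ l, (w :: l).IsChain K.edge ∧ (w :: l).getLast? = some b ∧
        ∀ m ∈ w :: l, m ≠ b → m ∉ O := by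
      clear haw
      induction hwb using Relation.ReflTransGen.head_induction_on with
      | refl => exact ⟨[], by simp, by simp, by simp⟩
      | @head x y hxy _ ih =>
        obtain ⟨l, h1, h2, h3⟩ := ih
        refine ⟨y :: l, List.isChain_cons_cons.2 ⟨hxy.2, h1⟩, by simpa using h2, ?_⟩
        intro m hm
        rcases List.mem_cons.1 hm with rfl | hm
        · exact fun _ => hxy.1
        · exact h3 m hm
    obtain ⟨l, h1, h2, h3⟩ := this
    refine ⟨a :: w :: l, by simp, by simpa using h2, List.isChain_cons_cons.2 ⟨haw, h1⟩, ?_⟩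
    intro m hm hma hmb
    rcases List.mem_cons.1 hm with rfl | hm
    · exact absurd rfl hma
    · exact h3 m hm hmb

/-- Repetitions are excluded by acyclicity. The ancestral information about each vertex is kept for
gluing two such paths at a common source. -/
theorem exists_directed_list {K : DAG W} {O : Set W} {w b : W} (h : K.LatentAnc O w b) :
    w ≠ b → ∃ p, (w :: p).Nodup ∧ (w :: p).IsChain K.edge ∧
      (∃ n, [n, b] <:+ w :: p ∧ K.edge n b) ∧
      ∀ c ∈ w :: p, Relation.ReflTransGen K.edge w c ∧ K.LatentAnc O c b ∧ (c ≠ b → c ∉ O) := by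
  induction h using Relation.ReflTransGen.head_induction_on with
  | refl => exact fun h => absurd rfl h
  | @head x y hxy hyb ih =>
    intro hxb
    by_cases hy : y = b
    · subst hy
      refine ⟨[y], by simp [hxb], by simp [hxy.2], ⟨x, List.suffix_rfl, hxy.2⟩, ?_⟩
      intro c hc
      rcases List.mem_pair.1 hc with rfl | rfl
      · exact ⟨.refl, .single hxy, fun _ => hxy.1⟩
      · exact ⟨.single hxy.2, .refl, fun h => absurd rfl h⟩
    · obtain ⟨p, h1, h2, ⟨n, h3, h3'⟩, h4⟩ := ih hy
      refine ⟨y :: p, List.nodup_cons.2 ⟨fun hx => ?_, h1⟩,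
        List.isChain_cons_cons.2 ⟨hxy.2, h2⟩, ⟨n, h3.trans (List.suffix_cons _ _), h3'⟩, ?_⟩
      · exact not_edge_of_reflTransGen (h4 x hx).1 hxy.2
      · intro c hc
        rcases List.mem_cons.1 hc with rfl | hc
        · exact ⟨.refl, .head hxy hyb, fun _ => hxy.1⟩
        · exact ⟨.head hxy.2 (h4 c hc).1, (h4 c hc).2⟩

theorem not_hasCollider_of_isChain {K : DAG W} {p : List W} (h : p.IsChain K.edge) :
    ¬ K.HasCollider p := by
  rintro ⟨i, m, j, hp, -, hjm⟩
  have := h.infix hp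
  simp at this
  exact K.acyclic m (.tail (.single this.2) hjm)

/-- Two directed paths from a lowest common latent ancestor meet only there, so gluing them gives a
simple path whose apex is a fork. -/
theorem projBidirected_of_latentAnc [Finite W] {K : DAG W} {O : Set W} {a b : W} (hab : a ≠ b)
    (ha : a ∈ O) (hb : b ∈ O) {m : W} (hm : m ∉ O) (hma : K.LatentAnc O m a)
    (hmb : K.LatentAnc O m b) : K.ProjBidirected O a b := by
  induction m using K.wellFounded_swap_transGen.induction with
  | _ m ih =>
  -- Descend until no strict descendant of `m` is a common latent ancestor.
  by_cases hex : ∃ c, Relation.TransGen K.edge m c ∧ c ∉ O ∧ K.LatentAnc O c a ∧ K.LatentAnc O c b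
  · obtain ⟨c, h1, h2, h3, h4⟩ := hex
    exact ih c h1 h2 h3 h4
  have hmb' : m ≠ b := fun h => hm (h ▸ hb)
  have hma' : m ≠ a := fun h => hm (h ▸ ha)
  obtain ⟨q, q1, q2, q3, q4⟩ := exists_directed_list hmb hmb'
  -- The path from `m` to `b` is prolonged backwards along the path from `m` to `a`. Each vertex
  -- already listed is a latent ancestor of `b` or an ancestor of the head `y`. A repeated vertex
  -- would contradict the choice of `m` in the first case and acyclicity in the second.
  have key : ∀ y, K.LatentAnc O m y → K.LatentAnc O y a →
      ∃ p, (y :: p).Nodup ∧ (y :: p).IsChain (fun i j => K.edge i j ∨ K.edge j i) ∧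
        (y ≠ m → ∃ s, [y, s] <+: y :: p ∧ K.edge s y) ∧ (∃ n, [n, b] <:+ y :: p ∧ K.edge n b) ∧
        ¬ K.HasCollider (y :: p) ∧ ∀ c ∈ y :: p, (K.LatentAnc O c b ∧ (c ≠ b → c ∉ O)) ∨
          (Relation.ReflTransGen K.edge c y ∧ (c ≠ y → c ∉ O)) := by
    intro y hmy
    induction hmy with
    | refl =>
      exact fun _ => ⟨q, q1, q2.imp fun _ _ => Or.inl, fun h => absurd rfl h, q3,
        not_hasCollider_of_isChain q2, fun c hc => Or.inl (q4 c hc).2⟩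
    | @tail y z hmy hyz ih' =>
      intro hza
      obtain ⟨p, p1, p2, -, ⟨n, p4, p4'⟩, p5, p6⟩ := ih' (.head hyz hza)
      refine ⟨y :: p, List.nodup_cons.2 ⟨fun hz => ?_, p1⟩,
        List.isChain_cons_cons.2 ⟨.inr hyz.2, p2⟩, fun _ => ⟨y, by simp, hyz.2⟩,
        ⟨n, p4.trans (List.suffix_cons _ _), p4'⟩, ?_, ?_⟩
      · rcases p6 z hz with ⟨h1, h2⟩ | ⟨h1, -⟩
        · by_cases hzO : z ∈ O
          · exact hab ((hza.eq_of_mem hzO).symm.trans (h1.eq_of_mem hzO))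
          · exact hex ⟨z, .tail' (LatentAnc.reflTransGen hmy) hyz.2, hzO, hza, h1⟩
        · exact not_edge_of_reflTransGen h1 hyz.2
      · rintro ⟨i, k, j, h1, h2, h3⟩
        rcases List.infix_cons_iff.1 h1 with h1 | h1
        · simp at h1
          obtain ⟨rfl, rfl, -⟩ := h1
          exact K.acyclic _ (.tail (.single h2) hyz.2)
        · exact p5 ⟨i, k, j, h1, h2, h3⟩
      · intro c hc
        rcases List.mem_cons.1 hc with rfl | hc
        · exact .inr ⟨.refl, fun h => absurd rfl h⟩
        · rcases p6 c hc with h | ⟨h, h'⟩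
          · exact .inl h
          · refine .inr ⟨h.tail hyz.2, fun _ => ?_⟩
            by_cases hcy : c = y
            · exact hcy ▸ hyz.1
            · exact h' hcy
  obtain ⟨p, p1, p2, p3, p4, p5, p6⟩ := key a hma .refl
  refine ⟨hab, a :: p, p1, p2, p3 hma'.symm, p4, p5, fun c hc hca hcb => ?_⟩
  rcases p6 c hc with h | h
  · exact h.2 hcb
  · exact h.2 hca

/-- After a forward edge, a first backward edge would create a collider. -/
theorem isChain_of_not_hasCollider {K : DAG W} (l : List W) :
    ∀ c d, (c :: d :: l).IsChain (fun i j => K.edge i j ∨ K.edge j i) →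
      ¬ K.HasCollider (c :: d :: l) → K.edge c d → (c :: d :: l).IsChain K.edge := by
  induction l with
  | nil => intro c d _ _ h; simpa using h
  | cons e l ih =>
    intro c d h1 h2 h3
    refine List.isChain_cons_cons.2 ⟨h3, ih d e (List.isChain_cons_cons.1 h1).2 ?_ ?_⟩
    · rintro ⟨i, m, j, h⟩
      exact h2 ⟨i, m, j, h.1.trans (List.suffix_cons _ _).isInfix, h.2⟩
    · have := (List.isChain_cons_cons.1 (List.isChain_cons_cons.1 h1).2).1
      refine this.resolve_right fun h => h2 ⟨c, d, e, ?_, h3, h⟩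
      exact List.IsPrefix.isInfix (by simp)

theorem latentAnc_of_isChain' {K : DAG W} {O : Set W} {b : W} (l : List W) :
    ∀ c, (c :: l).IsChain K.edge → (c :: l).getLast? = some b →
      (∀ m ∈ c :: l, m ≠ b → m ∉ O) → K.LatentAnc O c b := by
  induction l with
  | nil =>
    intro c _ hb _
    obtain rfl : c = b := by simpa using hb
    exact .refl
  | cons d l ih =>
    intro c hc hb hO
    obtain ⟨hcd, hd⟩ := List.isChain_cons_cons.1 hc
    have hb' : (d :: l).getLast? = some b := by simpa using hb
    refine .head ⟨hO c (by simp) ?_, hcd⟩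
      (ih d hd hb' fun m hm => hO m (List.mem_cons_of_mem _ hm))
    rintro rfl
    exact not_edge_of_reflTransGen (reflTransGen_of_isChain hd hb') hcd

/-- A path without colliders first climbs and then only descends. The turning point is the common
ancestor; it exists because the last edge points into `b`, and it is latent because it is not `b`.
-/
theorem exists_apex {K : DAG W} {O : Set W} {b : W} (l : List W) :
    ∀ c d, (c :: d :: l).IsChain (fun i j => K.edge i j ∨ K.edge j i) →
      ¬ K.HasCollider (c :: d :: l) → (∃ n, [n, b] <:+ c :: d :: l ∧ K.edge n b) → K.edge d c →
      (d :: l).Nodup → (∀ m ∈ d :: l, m ≠ b → m ∉ O) →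
      ∃ m, m ∉ O ∧ K.LatentAnc O m c ∧ K.LatentAnc O m b := by
  induction l with
  | nil =>
    rintro c d - - ⟨n, h, hnb⟩ hdc - -
    have := h.eq_of_length (by simp)
    simp at this
    obtain ⟨rfl, rfl⟩ := this
    exact absurd (.tail (.single hnb) hdc) (K.acyclic _)
  | cons e l ih =>
    rintro c d h1 h2 ⟨n, h3, h3'⟩ h4 h6 h5
    have h2' : ¬ K.HasCollider (d :: e :: l) := by
      rintro ⟨i, m, j, h⟩
      exact h2 ⟨i, m, j, h.1.trans (List.suffix_cons _ _).isInfix, h.2⟩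
    have h1' := (List.isChain_cons_cons.1 h1).2
    have h3s : [n, b] <:+ d :: e :: l := by
      rcases List.suffix_cons_iff.1 h3 with h | h
      · simp at h
      · exact h
    have hlast : (d :: e :: l).getLast? = some b := by
      obtain ⟨t, ht⟩ := h3s
      rw [← ht]; simp
    rcases (List.isChain_cons_cons.1 h1').1 with hde | hed
    · have hch := isChain_of_not_hasCollider l d e h1' h2' hde
      have hanc := latentAnc_of_isChain' _ d hch hlast h5
      have hdb : d ≠ b := by
        rintro rfl
        have hb' : (e :: l).getLast? = some d := by simpa using hlast
        exact not_edge_of_reflTransGen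
          (reflTransGen_of_isChain (List.isChain_cons_cons.1 hch).2 hb') hde
      have hd := h5 d (by simp) hdb
      exact ⟨d, hd, .single ⟨hd, h4⟩, hanc⟩
    · obtain ⟨m, hm, hmd, hmb⟩ := ih d e h1' h2' ⟨n, h3s, h3'⟩ hed
        (List.nodup_cons.1 h6).2 fun m hm => h5 m (List.mem_cons_of_mem _ hm)
      have hdb : d ≠ b := by
        rintro rfl
        have hb' : (e :: l).getLast? = some d := by simpa using hlast
        exact (List.nodup_cons.1 h6).1 (List.mem_of_getLast? hb')
      exact ⟨m, hm, hmd.tail ⟨h5 d (by simp) hdb, h4⟩, hmb⟩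

theorem projBidirected_iff [Finite W] {K : DAG W} {O : Set W} {a b : W} (ha : a ∈ O)
    (hb : b ∈ O) :
    K.ProjBidirected O a b ↔ a ≠ b ∧ ∃ m, m ∉ O ∧ K.LatentAnc O m a ∧ K.LatentAnc O m b := by
  constructor
  · rintro ⟨hab, p, h1, h2, ⟨m, h3, h3'⟩, h4, h5, h6⟩
    obtain ⟨t, rfl⟩ := h3
    refine ⟨hab, exists_apex t a m h2 h5 h4 h3' (List.nodup_cons.1 h1).2 fun c hc hcb =>
      h6 c (List.mem_cons_of_mem _ hc) ?_ hcb⟩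
    rintro rfl
    exact (List.nodup_cons.1 h1).1 hc
  · rintro ⟨hab, m, hm, h1, h2⟩
    exact projBidirected_of_latentAnc hab ha hb hm h1 h2

end DAG

/-! ### The edges of the latent projection in terms of the original graph -/

namespace SMG

variable {V : Type}

/-- The vertices that stand for bidirected edges have no incoming edges, so a directed path never
enters them. -/
theorem latentAnc_inl_iff {G : SMG V} {Z : Set V} {w v : V} :
    G.toExplicitDAG.LatentAnc (Sum.inl '' Zᶜ) (.inl w) (.inl v) ↔ G.LatentAnc Zᶜ w v := by
  constructor
  · intro h
    generalize hs : (Sum.inl w : V ⊕ G.bidirected.edgeSet) = s at h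
    induction h using Relation.ReflTransGen.head_induction_on generalizing w with
    | refl => obtain rfl := Sum.inl_injective hs; exact .refl
    | @head x y hxy _ ih =>
      subst hs
      rcases y with y | e
      · exact .head ⟨fun h => hxy.1 ⟨w, h, rfl⟩, hxy.2⟩ (ih rfl)
      · exact hxy.2.elim
  · intro h
    induction h using Relation.ReflTransGen.head_induction_on with
    | refl => exact .refl
    | @head x y hxy _ ih =>
      have hxy' : G.toExplicitDAG.edge (.inl x) (.inl y) := hxy.2
      refine .head ⟨?_, hxy'⟩ ih
      rintro ⟨x', h, h'⟩
      exact hxy.1 (Sum.inl_injective h' ▸ h)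

theorem latentAnc_inr_iff {G : SMG V} {Z : Set V} {e : G.bidirected.edgeSet} {v : V} :
    G.toExplicitDAG.LatentAnc (Sum.inl '' Zᶜ) (.inr e) (.inl v) ↔
      ∃ w ∈ (e : Sym2 V), G.LatentAnc Zᶜ w v := by
  constructor
  · intro h
    rcases Relation.ReflTransGen.cases_head h with h | ⟨c, hc, h⟩
    · cases h
    · rcases c with w | e'
      · exact ⟨w, hc.2, latentAnc_inl_iff.1 h⟩
      · exact hc.2.elim
  · rintro ⟨w, hw, h⟩
    have hew : G.toExplicitDAG.edge (.inr e) (.inl w) := hw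
    exact .head ⟨by simp, hew⟩ (latentAnc_inl_iff.2 h)

theorem latentProjection_edge {G : SMG V} {Z : Set V} {a b : {v : V // v ∉ Z}} :
    (G.latentProjection Z).edge a b ↔ ∃ w, G.edge a w ∧ G.LatentAnc Zᶜ w b := by
  refine DAG.projDirected_iff.trans ⟨?_, ?_⟩
  · rintro ⟨-, w | e, h1, h2⟩
    · exact ⟨w, h1, latentAnc_inl_iff.1 h2⟩
    · exact h1.elim
  · rintro ⟨w, h1, h2⟩
    refine ⟨fun h => ?_, .inl w, h1, latentAnc_inl_iff.2 h2⟩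
    rw [Sum.inl_injective h] at h1
    exact DAG.not_edge_of_reflTransGen h2.reflTransGen h1

theorem latentProjection_adj [Finite V] {G : SMG V} {Z : Set V} {a b : {v : V // v ∉ Z}} :
    (G.latentProjection Z).bidirected.Adj a b ↔ a ≠ b ∧
      ((∃ z ∈ Z, G.LatentAnc Zᶜ z a ∧ G.LatentAnc Zᶜ z b) ∨
        ∃ e : G.bidirected.edgeSet, ∃ w ∈ (e : Sym2 V), ∃ w' ∈ (e : Sym2 V),
          G.LatentAnc Zᶜ w a ∧ G.LatentAnc Zᶜ w' b) := by
  refine (DAG.projBidirected_iff (O := Sum.inl '' Zᶜ) (a := .inl a.1)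
    (b := .inl b.1) ⟨a.1, a.2, rfl⟩ ⟨b.1, b.2, rfl⟩).trans (and_congr ?_ ⟨?_, ?_⟩)
  · simp [Subtype.ext_iff]
  · rintro ⟨z | e, h, h1, h2⟩
    · refine .inl ⟨z, ?_, latentAnc_inl_iff.1 h1, latentAnc_inl_iff.1 h2⟩
      by_contra hz
      exact h ⟨z, hz, rfl⟩
    · obtain ⟨w, hw, h1⟩ := latentAnc_inr_iff.1 h1
      obtain ⟨w', hw', h2⟩ := latentAnc_inr_iff.1 h2
      exact .inr ⟨e, w, hw, w', hw', h1, h2⟩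
  · rintro (⟨z, hz, h1, h2⟩ | ⟨e, w, hw, w', hw', h1, h2⟩)
    · refine ⟨.inl z, ?_, latentAnc_inl_iff.2 h1, latentAnc_inl_iff.2 h2⟩
      rintro ⟨x, hx, h⟩
      exact hx (Sum.inl_injective h ▸ hz)
    · exact ⟨.inr e, by simp, latentAnc_inr_iff.2 ⟨w, hw, h1⟩, latentAnc_inr_iff.2 ⟨w', hw', h2⟩⟩

end SMG

/-! ### Independence and events determined by cylinders -/

/-- If two measurable sets of a product space depend on disjoint sets of coordinates, then they are
independent. -/
theorem pi_inter_of_disjoint {E : Type} [Fintype E] {Ω : E → Type} [∀ e, MeasurableSpace (Ω e)]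
    (law : ∀ e, Measure (Ω e)) [∀ e, IsProbabilityMeasure (law e)] {S S' : Set (∀ e, Ω e)}
    (hS : MeasurableSet S) (hS' : MeasurableSet S') (I I' : Set E) (hI : Disjoint I I')
    (h : ∀ u u', (∀ e ∈ I, u e = u' e) → u ∈ S → u' ∈ S)
    (h' : ∀ u u', (∀ e ∈ I', u e = u' e) → u ∈ S' → u' ∈ S') :
    Measure.pi law (S ∩ S') = Measure.pi law S * Measure.pi law S' := by
  classical
  have hne : ∀ e, Nonempty (Ω e) := fun e => (law e).nonempty_of_neZero
  -- An arbitrary filling of the coordinates on which the sets do not depend.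
  let u₀ : ∀ e, Ω e := fun e => (hne e).some
  let Φ := MeasurableEquiv.piEquivPiSubtypeProd Ω (· ∈ I)
  have hΦ := measurePreserving_piEquivPiSubtypeProd law (· ∈ I)
  let A : Set (∀ e : {e // e ∈ I}, Ω e) := (fun a => Φ.symm (a, fun e => u₀ e)) ⁻¹' S
  let B : Set (∀ e : {e // e ∉ I}, Ω e) := (fun b => Φ.symm (fun e => u₀ e, b)) ⁻¹' S'
  have hA : MeasurableSet A := hS.preimage (Φ.symm.measurable.comp (by fun_prop))
  have hB : MeasurableSet B := hS'.preimage (Φ.symm.measurable.comp (by fun_prop))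
  have hSA : S = Φ ⁻¹' (A ×ˢ Set.univ) := by
    ext u
    have : ∀ e ∈ I, u e = Φ.symm ((Φ u).1, fun e => u₀ e) e := by
      intro e he
      change u e = if h : e ∈ I then u e else u₀ e
      simp [he]
    constructor
    · exact fun hu => ⟨h _ _ this hu, trivial⟩
    · exact fun hu => h _ _ (fun e he => (this e he).symm) hu.1
  have hSB : S' = Φ ⁻¹' (Set.univ ×ˢ B) := by
    ext u
    have : ∀ e ∈ I', u e = Φ.symm (fun e => u₀ e, (Φ u).2) e := by
      intro e he
      change u e = if h : e ∈ I then u₀ e else u e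
      simp [Set.disjoint_right.1 hI he]
    constructor
    · exact fun hu => ⟨trivial, h' _ _ this hu⟩
    · exact fun hu => h' _ _ (fun e he => (this e he).symm) hu.2
  rw [hSA, hSB, ← Set.preimage_inter, Set.prod_inter_prod, Set.univ_inter, Set.inter_univ,
    hΦ.measure_preimage (hA.prod hB).nullMeasurableSet,
    hΦ.measure_preimage (hA.prod .univ).nullMeasurableSet,
    hΦ.measure_preimage (MeasurableSet.univ.prod hB).nullMeasurableSet]
  simp [Measure.prod_prod]

/-- If two random assignments agree in distribution on the coordinates in `C`, then events that
depend only on these coordinates have the same probability. -/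
theorem measure_eq_of_forall_cylinder {W : Type} [Finite W] {D : W → Type} [∀ v, Finite (D v)]
    [∀ v, Nonempty (D v)] {Ω₁ Ω₂ : Type} [MeasurableSpace Ω₁] [MeasurableSpace Ω₂]
    (μ₁ : Measure Ω₁) (μ₂ : Measure Ω₂) (s₁ : Ω₁ → ∀ v, D v) (s₂ : Ω₂ → ∀ v, D v)
    (hs₁ : ∀ v d, MeasurableSet {u | s₁ u v = d}) (hs₂ : ∀ v d, MeasurableSet {u | s₂ u v = d})
    (C : Set W) (h : ∀ y : ∀ v, D v, μ₁ {u | ∀ v ∈ C, s₁ u v = y v} =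
      μ₂ {u | ∀ v ∈ C, s₂ u v = y v})
    (R : (∀ v, D v) → Prop) (hR : ∀ a b, (∀ v ∈ C, a v = b v) → R a → R b) :
    μ₁ {u | R (s₁ u)} = μ₂ {u | R (s₂ u)} := by
  classical
  have := Fintype.ofFinite W
  have := fun v => Fintype.ofFinite (D v)
  let ext' : (∀ v : C, D v) → ∀ v, D v := fun c v =>
    if hv : v ∈ C then c ⟨v, hv⟩ else Classical.arbitrary _
  have hext : ∀ c v (hv : v ∈ C), ext' c v = c ⟨v, hv⟩ := fun c v hv => by simp [ext', hv]
  have key : ∀ {Ω' : Type} [MeasurableSpace Ω'] (μ : Measure Ω') (s : Ω' → ∀ v, D v),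
      (∀ v d, MeasurableSet {u | s u v = d}) → μ {u | R (s u)} =
        ∑ c ∈ Finset.univ.filter fun c => R (ext' c), μ {u | ∀ v ∈ C, s u v = ext' c v} := by
    intro Ω' _ μ s hs
    rw [← measure_biUnion_finset]
    · congr 1
      ext u
      simp only [Set.mem_ofPred_eq, Finset.mem_filter, Finset.mem_univ, true_and, Set.mem_iUnion,
        exists_prop]
      constructor
      · intro hu
        have : ∀ v ∈ C, s u v = ext' (fun v => s u v) v := fun v hv =>
          (hext (fun v => s u v) v hv).symm
        exact ⟨fun v => s u v, hR _ _ this hu, this⟩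
      · rintro ⟨c, hc, hu⟩
        exact hR _ _ (fun v hv => (hu v hv).symm) hc
    · intro c _ c' _ hcc
      refine Set.disjoint_left.2 fun u hu hu' => hcc (funext fun v => ?_)
      rw [← hext c v v.2, ← hext c' v v.2, ← hu v v.2, ← hu' v v.2]
    · intro c _
      simp only [Set.ofPred_forall]
      exact MeasurableSet.iInter fun v => MeasurableSet.iInter fun _ => hs v _
  rw [key μ₁ s₁ hs₁, key μ₂ s₂ hs₂]
  exact Finset.sum_congr rfl fun c _ => h _

/-! ### Hedges, factors of latent variable models, and soundness -/

namespace SMG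

variable {W : Type}

/-- The set `T` is connected by bidirected edges. -/
def BidirectedConnected (H : SMG W) (T : Set W) : Prop :=
  ∀ S ⊆ T, S.Nonempty → S ≠ T → ∃ a ∈ S, ∃ b ∈ T \ S, H.bidirected.Adj a b

/-- A graphical obstruction to the identifiability of the causal effect of `X` on `Y`: a nested pair
`C ⊆ T` of sets that are connected by bidirected edges and such that the vertices in `T` have a
directed path to `C` in `T`, where `T` meets `X` and the vertices in `C` have directed paths to `Y`
inside a set `A` that does not meet `X`. -/
structure Hedge (H : SMG W) (X Y : Set W) where
  C : Set W
  T : Set W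
  A : Set W
  C_subset_T : C ⊆ T
  C_subset_A : C ⊆ A
  disjoint : Disjoint A X
  exists_child_A : ∀ v ∈ A, v ∉ Y → ∃ w ∈ A, H.edge v w
  exists_child_T : ∀ v ∈ T, v ∉ C → ∃ w ∈ T, H.edge v w
  connected_C : H.BidirectedConnected C
  connected_T : H.BidirectedConnected T
  nonempty_C : C.Nonempty
  nonempty_TX : (T ∩ X).Nonempty

end SMG

/-- A model whose observed variables satisfy the constraints that the graph `H` imposes. In contrast
to a semi-Markovian model, an unobserved variable may affect any number of observed ones. -/
structure LatentModel {W : Type} (H : SMG W) (D : W → Type) where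
  U : Type
  [fintypeU : Fintype U]
  Ω : U → Type
  [measurableSpaceΩ : ∀ e, MeasurableSpace (Ω e)]
  law : ∀ e, Measure (Ω e)
  [isProbabilityMeasure_law : ∀ e, IsProbabilityMeasure (law e)]
  paU : W → Set U
  f : ∀ v, (∀ w, D w) → (∀ e, Ω e) → D v
  f_congr : ∀ v a a' u u', (∀ w, H.edge w v → a w = a' w) → (∀ e ∈ paU v, u e = u' e) →
    f v a u = f v a' u'
  measurableSet_f : ∀ v a d, MeasurableSet {u | f v a u = d}
  adj : ∀ v w e, v ≠ w → e ∈ paU v → e ∈ paU w → H.bidirected.Adj v w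

namespace LatentModel

attribute [instance] fintypeU measurableSpaceΩ isProbabilityMeasure_law

variable {W : Type} {H : SMG W} {D : W → Type}

/-- The probability that the functions of the variables in `C` take the values prescribed by `o`
when their observed parents have the values prescribed by `o`. -/
noncomputable def Q (M : LatentModel H D) (C : Set W) (o : ∀ v, D v) : ℝ≥0∞ :=
  Measure.pi M.law {u | ∀ v ∈ C, M.f v o u = o v}

theorem measurableSet_Q [Finite W] (M : LatentModel H D) (C : Set W) (a o : ∀ v, D v) :
    MeasurableSet {u | ∀ v ∈ C, M.f v a u = o v} := by
  simp only [Set.ofPred_forall]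
  exact MeasurableSet.iInter fun v => MeasurableSet.iInter fun _ => M.measurableSet_f v _ _

theorem Q_mono (M : LatentModel H D) {C C' : Set W} (h : C ⊆ C') (o : ∀ v, D v) :
    M.Q C' o ≤ M.Q C o :=
  measure_mono fun _ hu v hv => hu v (h hv)

theorem Q_ne_top (M : LatentModel H D) (C : Set W) (o : ∀ v, D v) : M.Q C o ≠ ∞ :=
  measure_ne_top _ _

theorem Q_empty (M : LatentModel H D) (o : ∀ v, D v) : M.Q ∅ o = 1 := by
  simp [Q]

-- No function of `insert v C` has `v` as an argument, so changing the assignment at `v` only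
-- changes the value required of the function of `v`. These events partition the event for `C`.
open Classical in
theorem sum_Q_insert [Finite W] (M : LatentModel H D) {C : Set W} {v : W} [Fintype (D v)]
    (hv : v ∉ C) (hch : ∀ w ∈ C, ¬ H.edge v w) (o : ∀ v, D v) :
    ∑ d, M.Q (insert v C) (Function.update o v d) = M.Q C o := by
  have hf : ∀ w ∈ insert v C, ∀ d u, M.f w (Function.update o v d) u = M.f w o u := by
    intro w hw d u
    refine M.f_congr _ _ _ _ _ (fun x hx => ?_) fun _ _ => rfl
    rw [Function.update_of_ne]
    rintro rfl
    rcases hw with rfl | hw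
    · exact H.acyclic _ (.single hx)
    · exact hch w hw hx
  unfold Q
  rw [← measure_biUnion_finset]
  · congr 1
    ext u
    simp only [Set.mem_iUnion, Finset.mem_univ, Set.mem_ofPred_eq, exists_prop, true_and]
    constructor
    · rintro ⟨d, hd⟩ w hw
      have := hd w (.inr hw)
      rw [hf w (.inr hw), Function.update_of_ne] at this
      · exact this
      · rintro rfl; exact hv hw
    · intro h
      refine ⟨M.f v o u, fun w hw => ?_⟩
      rw [hf w hw]
      by_cases hwv : w = v
      · subst hwv; simp
      · rw [Function.update_of_ne hwv]
        exact h w (hw.resolve_left hwv)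
  · intro d _ d' _ hdd
    refine Set.disjoint_left.2 fun u hu hu' => hdd ?_
    have h1 := hu v (.inl rfl)
    have h2 := hu' v (.inl rfl)
    rw [hf v (.inl rfl)] at h1 h2
    simpa using h1.symm.trans h2
  · exact fun d _ => M.measurableSet_Q _ _ _

/-- Without bidirected edges across, the two sets of functions share no unobserved variable and are
independent. -/
theorem Q_union [Finite W] (M : LatentModel H D) {A B : Set W} (hAB : Disjoint A B)
    (hadj : ∀ a ∈ A, ∀ b ∈ B, ¬ H.bidirected.Adj a b) (o : ∀ v, D v) :
    M.Q (A ∪ B) o = M.Q A o * M.Q B o := by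
  have : {u | ∀ v ∈ A ∪ B, M.f v o u = o v} =
      {u | ∀ v ∈ A, M.f v o u = o v} ∩ {u | ∀ v ∈ B, M.f v o u = o v} := by
    ext u
    simp only [Set.mem_ofPred_eq, Set.mem_inter_iff, Set.mem_union, or_imp, forall_and]
  unfold Q
  rw [this]
  have hdep : ∀ C : Set W, ∀ u u', (∀ e ∈ ⋃ v ∈ C, M.paU v, u e = u' e) →
      u ∈ {u | ∀ v ∈ C, M.f v o u = o v} → u' ∈ {u | ∀ v ∈ C, M.f v o u = o v} := by
    intro C u u' h hu v hv
    rw [← hu v hv]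
    refine M.f_congr _ _ _ _ _ (fun _ _ => rfl) fun e he => (h e ?_).symm
    simp only [Set.mem_iUnion]
    exact ⟨v, hv, he⟩
  refine pi_inter_of_disjoint M.law (M.measurableSet_Q _ _ _) (M.measurableSet_Q _ _ _) _ _ ?_
    (hdep A) (hdep B)
  simp only [Set.disjoint_left, Set.mem_iUnion, not_exists]
  rintro e ⟨a, ha, hea⟩ b hb heb
  refine hadj a ha b hb (M.adj a b e ?_ hea heb)
  rintro rfl
  exact Set.disjoint_left.1 hAB ha hb

/-- If `A ∪ X` contains the parents of all elements of `A`, then the interventional distribution of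
`A` is given by the factor of `A`. -/
theorem measure_solution_eq_Q [Finite W] (M : LatentModel H D) {X A : Set W} (hAX : Disjoint A X)
    (hclosed : ∀ v w, w ∈ A → H.edge v w → v ∉ X → v ∈ A) (x o : ∀ v, D v)
    (s : (∀ e, M.Ω e) → ∀ v, D v) (hs : ∀ u, ∀ v ∉ X, s u v = M.f v (s u) u)
    (hsX : ∀ u, ∀ v ∈ X, s u v = x v) (ho : ∀ v ∈ X, o v = x v) :
    Measure.pi M.law {u | ∀ v ∈ A, s u v = o v} = M.Q A o := by
  unfold Q
  congr 1
  ext u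
  constructor
  · intro h v hv
    rw [← h v hv, hs u v (Set.disjoint_left.1 hAX hv)]
    refine M.f_congr _ _ _ _ _ (fun w hw => ?_) fun _ _ => rfl
    by_cases hwX : w ∈ X
    · rw [ho w hwX, hsX u w hwX]
    · exact (h w (hclosed w v hv hw hwX)).symm
  · intro h v
    induction v using H.wellFounded_edge.induction with
    | _ v ih =>
    intro hv
    rw [← h v hv, hs u v (Set.disjoint_left.1 hAX hv)]
    refine M.f_congr _ _ _ _ _ (fun w hw => ?_) fun _ _ => rfl
    by_cases hwX : w ∈ X
    · rw [ho w hwX, hsX u w hwX]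
    · exact ih w hw (hclosed w v hv hw hwX)

variable [Finite W] [∀ v, Finite (D v)] {M₁ M₂ : LatentModel H D}

theorem Q_eq_of_insert {C : Set W} {v : W} (hv : v ∉ C) (hch : ∀ w ∈ C, ¬ H.edge v w)
    (h : M₁.Q (insert v C) = M₂.Q (insert v C)) : M₁.Q C = M₂.Q C := by
  have := Fintype.ofFinite (D v)
  funext o
  rw [← M₁.sum_Q_insert hv hch, ← M₂.sum_Q_insert hv hch, h]

/-- Sum out a vertex without children in the union. If it lies in `B`, induction applies to `A` and
the rest of `B`. If it lies in `A`, induction with the roles exchanged gives equality on `B`, and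
the positive factor of `B` cancels from the product. -/
theorem Q_eq_of_union (hpos : ∀ o, 0 < M₁.Q Set.univ o) (n : ℕ) :
    ∀ A B : Set W, Disjoint A B → (∀ a ∈ A, ∀ b ∈ B, ¬ H.bidirected.Adj a b) →
      (A ∪ B).ncard = n → M₁.Q (A ∪ B) = M₂.Q (A ∪ B) → M₁.Q A = M₂.Q A := by
  have cancel : ∀ A B : Set W, Disjoint A B → (∀ a ∈ A, ∀ b ∈ B, ¬ H.bidirected.Adj a b) →
      M₁.Q (A ∪ B) = M₂.Q (A ∪ B) → M₁.Q B = M₂.Q B → M₁.Q A = M₂.Q A := by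
    intro A B hAB hadj h hB
    funext o
    have ho := congrFun h o
    rw [M₁.Q_union hAB hadj, M₂.Q_union hAB hadj, ← hB] at ho
    refine (ENNReal.mul_left_inj ?_ (M₁.Q_ne_top B o)).1 ho
    exact ((hpos o).trans_le (M₁.Q_mono (Set.subset_univ B) o)).ne'
  induction n with
  | zero =>
    intro A B hAB _ hn _
    have : A = ∅ := by
      have := (Set.ncard_eq_zero (Set.toFinite _)).1 hn
      exact (Set.union_empty_iff.1 this).1
    subst this
    funext o
    simp [Q_empty]
  | succ n ih =>
    intro A B hAB hadj hn h
    have hne : (A ∪ B).Nonempty := by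
      rw [← Set.ncard_pos (Set.toFinite _)]; omega
    obtain ⟨v, hv, hmax⟩ := H.wellFounded_swap_transGen.has_min _ hne
    have hch : ∀ w ∈ A ∪ B, ¬ H.edge v w := fun w hw hvw => hmax w hw (.single hvw)
    have hadj' : ∀ b ∈ B, ∀ a ∈ A, ¬ H.bidirected.Adj b a := fun b hb a ha h => hadj a ha b hb h.symm
    have hrem : ∀ A' B' : Set W, v ∉ A' ∪ B' → insert v (A' ∪ B') = A ∪ B →
        (A' ∪ B').ncard = n ∧ M₁.Q (A' ∪ B') = M₂.Q (A' ∪ B') := by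
      intro A' B' hv' hins
      constructor
      · have := Set.ncard_insert_of_notMem hv' (Set.toFinite _)
        rw [hins, hn] at this
        omega
      · refine Q_eq_of_insert hv' (fun w hw => hch w ?_) (hins ▸ h)
        rw [← hins]; exact .inr hw
    by_cases hvA : v ∈ A
    · have hvB : v ∉ B := Set.disjoint_left.1 hAB hvA
      refine cancel A B hAB hadj h ?_
      obtain ⟨h1, h2⟩ := hrem B (A \ {v}) (by simp [hvB]) (by
        ext w; by_cases hw : w = v <;> simp [hw, hvA, or_comm])
      exact ih B (A \ {v}) (hAB.symm.mono_right Set.sdiff_subset)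
        (fun b hb a ha => hadj' b hb a ha.1) h1 h2
    · have hvB : v ∈ B := hv.resolve_left hvA
      obtain ⟨h1, h2⟩ := hrem A (B \ {v}) (by simp [hvA]) (by
        ext w; by_cases hw : w = v <;> simp [hw, hvB])
      exact ih A (B \ {v}) (hAB.mono_right Set.sdiff_subset)
        (fun a ha b hb => hadj a ha b hb.1) h1 h2

/-- In the absence of hedges, the factors of the sets of ancestors of `Y` can be computed from the
observed distribution. -/
theorem Q_eq_of_isEmpty_hedge (hpos : ∀ o, 0 < M₁.Q Set.univ o)
    (h : M₁.Q Set.univ = M₂.Q Set.univ) {X Y : Set W} (hH : IsEmpty (H.Hedge X Y)) {A : Set W}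
    (hAX : Disjoint A X) (hchild : ∀ v ∈ A, v ∉ Y → ∃ w ∈ A, H.edge v w)
    (hclosed : ∀ v w, w ∈ A → H.edge v w → v ∉ X → v ∈ A) (n : ℕ) :
    ∀ C ⊆ A, (∀ a ∈ C, ∀ b ∈ A \ C, ¬ H.bidirected.Adj a b) → C.ncard = n → M₁.Q C = M₂.Q C := by
  induction n using Nat.strong_induction_on with
  | _ n ih =>
  intro C hCA hadj hn
  rcases C.eq_empty_or_nonempty with rfl | hC
  · funext o; simp [Q_empty]
  by_cases hconn : H.BidirectedConnected C
  · have hfin : ({T : Set W | C ⊆ T ∧ M₁.Q T = M₂.Q T}).Finite := Set.toFinite _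
    -- Among the supersets of `C` on which the two models have equal factors, a minimal one admits
    -- neither summing out nor splitting; these are the two conditions on the larger set of a hedge.
    obtain ⟨T, ⟨hCT, hT⟩, hmin⟩ := hfin.exists_minimal ⟨Set.univ, Set.subset_univ _, h⟩
    have hmin' : ∀ S, C ⊆ S → M₁.Q S = M₂.Q S → S ⊆ T → S = T := fun S h1 h2 h3 =>
      h3.antisymm (hmin ⟨h1, h2⟩ h3)
    have hTchild : ∀ v ∈ T, v ∉ C → ∃ w ∈ T, H.edge v w := by
      intro v hv hvC
      by_contra! hno
      have := hmin' (T \ {v}) (fun w hw => ⟨hCT hw, fun h => hvC (h ▸ hw)⟩)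
        (Q_eq_of_insert (v := v) (by simp) (fun w hw => hno w hw.1)
          (by rwa [Set.insert_sdiff_singleton, Set.insert_eq_of_mem hv])) Set.sdiff_subset
      rw [← this] at hv
      exact hv.2 rfl
    have hTconn : H.BidirectedConnected T := by
      intro S hST hS hne
      by_contra! hno
      have hadj' : ∀ a ∈ S, ∀ b ∈ T \ S, ¬ H.bidirected.Adj a b := hno
      have hun : S ∪ T \ S = T := Set.union_sdiff_cancel hST
      have h1 : M₁.Q S = M₂.Q S := Q_eq_of_union hpos _ S (T \ S) Set.disjoint_sdiff_right hadj'
        rfl (by rwa [hun])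
      have h2 : M₁.Q (T \ S) = M₂.Q (T \ S) := Q_eq_of_union hpos _ (T \ S) S
        Set.disjoint_sdiff_left (fun a ha b hb h => hadj' b hb a ha h.symm) rfl
        (by rwa [Set.union_comm, hun])
      -- Connectedness puts `C` on one side of the split, and that side contradicts minimality.
      by_cases hCS : C ∩ S = ∅
      · have := hmin' (T \ S) (fun c hc => ⟨hCT hc, fun hcS => ?_⟩) h2 Set.sdiff_subset
        · obtain ⟨s, hs⟩ := hS
          have := hST hs
          rw [← ‹T \ S = T›] at this
          exact this.2 hs
        · exact (hCS ▸ (⟨hc, hcS⟩ : c ∈ C ∩ S) : c ∈ (∅ : Set W))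
      · by_cases hCS' : C ∩ S = C
        · exact hne (hmin' S (Set.inter_eq_left.1 hCS') h1 hST)
        · obtain ⟨a, ha, b, hb, hab⟩ := hconn (C ∩ S) Set.inter_subset_left
            (Set.nonempty_iff_ne_empty.2 hCS) hCS'
          exact hadj' a ha.2 b ⟨hCT hb.1, fun hbS => hb.2 ⟨hb.1, hbS⟩⟩ hab
    by_cases hTX : (T ∩ X).Nonempty
    · exact (hH.false ⟨C, T, A, hCT, hCA, hAX, hchild, hTchild, hconn, hTconn, hC, hTX⟩).elim
    -- When `T` avoids `X`, its vertices are ancestors of `C` through vertices outside `X`, so they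
    -- lie in `A`. As no bidirected edge leaves `C` within `A`, connectedness of `T` forces `C = T`.
    · have hTA : T ⊆ A := by
        intro v
        induction v using H.wellFounded_swap_transGen.induction with
        | _ v ihv =>
        intro hv
        by_cases hvC : v ∈ C
        · exact hCA hvC
        · obtain ⟨w, hw, hvw⟩ := hTchild v hv hvC
          exact hclosed v w (ihv w (.single hvw) hw) hvw fun hvX => hTX ⟨v, hv, hvX⟩
      by_cases hCT' : C = T
      · rw [hCT', hT]
      · obtain ⟨a, ha, b, hb, hab⟩ := hTconn C hCT hC hCT'
        exact (hadj a ha b ⟨hTA hb.1, hb.2⟩ hab).elim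
  · unfold SMG.BidirectedConnected at hconn
    push Not at hconn
    obtain ⟨S, hSC, hS, hne, hno⟩ := hconn
    have hun : S ∪ C \ S = C := Set.union_sdiff_cancel hSC
    have hlt : S.ncard < C.ncard := Set.ncard_lt_ncard (hSC.ssubset_of_ne hne) (Set.toFinite _)
    have hlt' : (C \ S).ncard < C.ncard := Set.ncard_lt_ncard
      (Set.sdiff_subset.ssubset_of_ne fun h => by
        obtain ⟨s, hs⟩ := hS
        have := hSC hs
        rw [← h] at this
        exact this.2 hs) (Set.toFinite _)
    have h1 := ih _ (hn ▸ hlt) S (hSC.trans hCA) (fun a ha b hb hab => by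
      by_cases hbC : b ∈ C
      · exact hno a ha b ⟨hbC, hb.2⟩ hab
      · exact hadj a (hSC ha) b ⟨hb.1, hbC⟩ hab) rfl
    have h2 := ih _ (hn ▸ hlt') (C \ S) (Set.sdiff_subset.trans hCA) (fun a ha b hb hab => by
      by_cases hbC : b ∈ C
      · refine hno b ?_ a ha hab.symm
        by_contra hbS
        exact hb.2 ⟨hbC, hbS⟩
      · exact hadj a ha.1 b ⟨hb.1, hbC⟩ hab) rfl
    funext o
    rw [← hun, M₁.Q_union Set.disjoint_sdiff_right hno, M₂.Q_union Set.disjoint_sdiff_right hno,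
      h1, h2]

open Classical in
/-- In the absence of hedges, the causal effect is determined by the observed distribution. -/
theorem effect_eq_of_isEmpty_hedge [∀ v, Nonempty (D v)] (hpos : ∀ o, 0 < M₁.Q Set.univ o)
    (h : ∀ o, M₁.Q Set.univ o = M₂.Q Set.univ o) {X Y : Set W} (hXY : Disjoint X Y)
    (hH : IsEmpty (H.Hedge X Y)) (x y : ∀ v, D v)
    (s₁ : (∀ e, M₁.Ω e) → ∀ v, D v) (hs₁ : ∀ u, ∀ v ∉ X, s₁ u v = M₁.f v (s₁ u) u)
    (hsX₁ : ∀ u, ∀ v ∈ X, s₁ u v = x v) (hm₁ : ∀ v d, MeasurableSet {u | s₁ u v = d})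
    (s₂ : (∀ e, M₂.Ω e) → ∀ v, D v) (hs₂ : ∀ u, ∀ v ∉ X, s₂ u v = M₂.f v (s₂ u) u)
    (hsX₂ : ∀ u, ∀ v ∈ X, s₂ u v = x v) (hm₂ : ∀ v d, MeasurableSet {u | s₂ u v = d}) :
    Measure.pi M₁.law {u | ∀ v ∈ Y, s₁ u v = y v} =
      Measure.pi M₂.law {u | ∀ v ∈ Y, s₂ u v = y v} := by
  -- The ancestors of `Y` after removal of the edges out of `X`.
  let A : Set W := {v | ∃ w ∈ Y, Relation.ReflTransGen (fun a b => a ∉ X ∧ H.edge a b) v w}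
  have hYA : Y ⊆ A := fun v hv => ⟨v, hv, .refl⟩
  have hAX : Disjoint A X := by
    refine Set.disjoint_left.2 ?_
    rintro v ⟨w, hw, hvw⟩ hv
    rcases Relation.ReflTransGen.cases_head hvw with rfl | ⟨c, hc, -⟩
    · exact Set.disjoint_left.1 hXY hv hw
    · exact hc.1 hv
  have hclosed : ∀ v w, w ∈ A → H.edge v w → v ∉ X → v ∈ A := by
    rintro v w ⟨z, hz, hwz⟩ hvw hv
    exact ⟨z, hz, .head ⟨hv, hvw⟩ hwz⟩
  have hchild : ∀ v ∈ A, v ∉ Y → ∃ w ∈ A, H.edge v w := by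
    rintro v ⟨w, hw, hvw⟩ hv
    rcases Relation.ReflTransGen.cases_head hvw with rfl | ⟨c, hc, hcw⟩
    · exact absurd hw hv
    · exact ⟨c, ⟨w, hw, hcw⟩, hc.2⟩
  have hQ := Q_eq_of_isEmpty_hedge hpos (funext h) hH hAX hchild hclosed _ A subset_rfl
    (fun a _ b hb => absurd hb.1 hb.2) rfl
  refine measure_eq_of_forall_cylinder _ _ s₁ s₂ hm₁ hm₂ A (fun a => ?_)
    (fun a => ∀ v ∈ Y, a v = y v) fun a b hab ha v hv => (hab v (hYA hv)).symm.trans (ha v hv)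
  -- Parents of `A` outside `A` lie in `X`, so the factor of `A` must be evaluated with the
  -- intervened values there.
  let o : ∀ v, D v := fun v => if v ∈ X then x v else a v
  have hoX : ∀ v ∈ X, o v = x v := fun v hv => if_pos hv
  have hoA : ∀ v ∈ A, a v = o v := fun v hv => (if_neg (Set.disjoint_left.1 hAX hv)).symm
  have h1 := M₁.measure_solution_eq_Q hAX hclosed x o s₁ hs₁ hsX₁ hoX
  have h2 := M₂.measure_solution_eq_Q hAX hclosed x o s₂ hs₂ hsX₂ hoX
  rw [hQ, ← h2] at h1
  have hao : ∀ b : ∀ v, D v, (∀ v ∈ A, b v = a v) ↔ ∀ v ∈ A, b v = o v := fun b =>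
    forall₂_congr fun v hv => by rw [hoA v hv]
  simp only [hao]
  exact h1

end LatentModel

/-! ### Solutions of causal models and their projection to latent variable models -/

namespace CausalModel

variable {V : Type} {D : V → Type}

section solution

variable [Finite V] [∀ v, Nonempty (D v)]

theorem solution_spec (M : CausalModel V D) (u : ∀ e, M.Ω e) (v : V) :
    M.solution u v = M.f v (M.solution u) u :=
  (M.existsUnique_solution u).choose_spec.1 v

theorem eq_solution (M : CausalModel V D) {u : ∀ e, M.Ω e} {a : ∀ v, D v}
    (h : ∀ v, a v = M.f v a u) : a = M.solution u :=
  (M.existsUnique_solution u).choose_spec.2 a h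

/-- Measurability of the functions is given only for a fixed assignment. A fixed assignment is the
solution exactly when it satisfies all equations, and there are finitely many assignments. -/
theorem measurableSet_solution [∀ v, Finite (D v)] (M : CausalModel V D) (v : V) (d : D v) :
    MeasurableSet {u | M.solution u v = d} := by
  have key : ∀ a : ∀ v, D v, MeasurableSet {u | M.solution u = a} := by
    intro a
    have : {u | M.solution u = a} = ⋂ w, M.f w a ⁻¹' {a w} := by
      ext u
      simp only [Set.mem_ofPred_eq, Set.mem_iInter, Set.mem_preimage, Set.mem_singleton_iff]
      constructor
      · rintro rfl w
        exact (M.solution_spec u w).symm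
      · exact fun h => (M.eq_solution fun w => (h w).symm).symm
    rw [this]
    exact MeasurableSet.iInter fun w => M.measurable_f w a (by trivial)
  have : {u | M.solution u v = d} = ⋃ a ∈ {a : ∀ v, D v | a v = d}, {u | M.solution u = a} := by
    ext u
    simp
  rw [this]
  exact MeasurableSet.biUnion (Set.toFinite _).countable fun a _ => key a

theorem solution_intervene_of_mem (M : CausalModel V D) {X : Set V} (x : ∀ v, D v)
    (u : ∀ e, M.Ω e) {v : V} (hv : v ∈ X) : (M.intervene X x).solution u v = x v :=
  ((M.intervene X x).solution_spec u v).trans (if_pos hv)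

theorem solution_intervene_of_notMem (M : CausalModel V D) {X : Set V} (x : ∀ v, D v)
    (u : ∀ e, M.Ω e) {v : V} (hv : v ∉ X) :
    (M.intervene X x).solution u v = M.f v ((M.intervene X x).solution u) u :=
  ((M.intervene X x).solution_spec u v).trans (if_neg hv)

theorem eq_solution_intervene (M : CausalModel V D) {X : Set V} {x : ∀ v, D v}
    {u : ∀ e, M.Ω e} {a : ∀ v, D v} (hX : ∀ v ∈ X, a v = x v)
    (h : ∀ v ∉ X, a v = M.f v a u) : a = (M.intervene X x).solution u := by
  refine (M.intervene X x).eq_solution fun v => ?_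
  by_cases hv : v ∈ X
  · exact (hX v hv).trans (if_pos hv).symm
  · exact (h v hv).trans (if_neg hv).symm

theorem measurableSet_solution_intervene [∀ v, Finite (D v)] (M : CausalModel V D) (X : Set V)
    (x : ∀ v, D v) (v : V) (d : D v) :
    MeasurableSet {u : ∀ e, M.Ω e | (M.intervene X x).solution u v = d} :=
  (M.intervene X x).measurableSet_solution v d

theorem causalEffect_eq (M : CausalModel V D) (X : Set V) (x : ∀ v, D v) (Y : Set V)
    (y : ∀ v, D v) : M.causalEffect X x Y y =
      Measure.pi M.law {u | ∀ v ∈ Y, (M.intervene X x).solution u v = y v} := rfl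

end solution

/-- A semi-Markovian model, regarded as a latent variable model. -/
def toLatentModel [∀ v, Finite (D v)] (M : CausalModel V D) {G : SMG V} (hM : M.Induces G) :
    LatentModel G D where
  U := M.U
  Ω := M.Ω
  law := M.law
  paU := M.paU
  f := M.f
  f_congr v a a' u u' h h' := M.f_congr v a a' u u' (fun w hw => h w ((hM.1 w v).2 hw)) h'
  measurableSet_f v a d := M.measurable_f v a (by trivial : @MeasurableSet _ ⊤ {d})
  adj v w e hvw hv hw := (hM.2 v w).2 ⟨hvw, e, hv, hw⟩

open Classical in
/-- The extension of an assignment of values to the variables outside `Z`. -/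
noncomputable def extend [∀ v, Nonempty (D v)] (Z : Set V) (a : ∀ v : {v // v ∉ Z}, D v) : ∀ v, D v :=
  fun v => if h : v ∉ Z then a ⟨v, h⟩ else Classical.arbitrary _

theorem extend_apply [∀ v, Nonempty (D v)] (Z : Set V) (a : ∀ v : {v // v ∉ Z}, D v) (v : {v // v ∉ Z}) :
    extend Z a v = a v := dif_pos v.2

variable [Finite V] [∀ v, Finite (D v)] [∀ v, Nonempty (D v)]

theorem prob_univ_eq_Q (M : CausalModel V D) {G : SMG V} (hM : M.Induces G) (o : ∀ v, D v) :
    M.prob Set.univ o = (M.toLatentModel hM).Q Set.univ o :=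
  (M.toLatentModel hM).measure_solution_eq_Q (X := ∅) (by simp) (by simp) o o M.solution
    (fun u v _ => M.solution_spec u v) (by simp) (by simp)

/-- The latent variable model on the variables outside `Z` that results from a semi-Markovian model
by substituting the functions of the variables in `Z`. -/
noncomputable def project (M : CausalModel V D) {G : SMG V} (hM : M.Induces G) (Z : Set V) :
    LatentModel (G.latentProjection Z) (fun v : {v // v ∉ Z} => D v) where
  U := M.U
  Ω := M.Ω
  law := M.law
  paU v := {e | ∃ w, G.LatentAnc Zᶜ w v ∧ e ∈ M.paU w}
  f v a u := (M.intervene {w | w ∉ Z ∧ w ≠ v} (extend Z a)).solution u v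
  f_congr v a a' u u' h h' := by
    -- Only latent ancestors of `v` are computed on the way to `v`. Any other parent met on the way
    -- is observed and distinct from `v` by acyclicity, hence held fixed; it is a parent of `v` in
    -- the projection.
    have key : ∀ w, G.LatentAnc Zᶜ w v →
        (M.intervene {w | w ∉ Z ∧ w ≠ v} (extend Z a)).solution u w =
          (M.intervene {w | w ∉ Z ∧ w ≠ v} (extend Z a')).solution u' w := by
      intro w
      induction w using G.wellFounded_edge.induction with
      | _ w ih =>
      intro hw
      have hwn : w ∉ {w | w ∉ Z ∧ w ≠ v} := fun hn => hn.2 (hw.eq_of_mem hn.1)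
      rw [M.solution_intervene_of_notMem _ _ hwn, M.solution_intervene_of_notMem _ _ hwn]
      refine M.f_congr _ _ _ _ _ (fun p hp => ?_) fun e he => h' e ⟨w, hw, he⟩
      have hpw : G.edge p w := (hM.1 p w).2 hp
      by_cases hpZ : p ∈ Z
      · exact ih p hpw (.head ⟨fun h => h hpZ, hpw⟩ hw)
      · have hpn : p ∈ {w | w ∉ Z ∧ w ≠ v.1} :=
          ⟨hpZ, fun hpv => DAG.not_edge_of_reflTransGen hw.reflTransGen (hpv ▸ hpw)⟩
        rw [M.solution_intervene_of_mem _ _ hpn, M.solution_intervene_of_mem _ _ hpn,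
          extend_apply Z a ⟨p, hpZ⟩, extend_apply Z a' ⟨p, hpZ⟩]
        exact h ⟨p, hpZ⟩ (SMG.latentProjection_edge.2 ⟨w, hpw, hw⟩)
    exact key v .refl
  measurableSet_f v a d := M.measurableSet_solution_intervene _ _ _ _
  adj v w e hvw := by
    rintro ⟨p, hp, hep⟩ ⟨q, hq, heq⟩
    refine SMG.latentProjection_adj.2 ⟨hvw, ?_⟩
    -- The shared unobserved variable enters at `p` on the way to `v` and at `q` on the way to `w`.
    -- If these agree they are a common ancestor in `Z`; otherwise they are joined by a bidirected
    -- edge.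
    by_cases hpq : p = q
    · subst hpq
      refine .inl ⟨p, ?_, hp, hq⟩
      by_contra hpZ
      exact hvw (Subtype.ext ((hp.eq_of_mem hpZ).symm.trans (hq.eq_of_mem hpZ)))
    · exact .inr ⟨⟨s(p, q), (hM.2 p q).2 ⟨hpq, e, hep, heq⟩⟩, p, by simp, q, by simp, hp, hq⟩

/-- Holding observed variables at the values that they already have does not change the solution.
Since `X` avoids `Z`, the functions substituted by the projection are not affected by the
intervention. -/
theorem project_f_solution (M : CausalModel V D) {G : SMG V} (hM : M.Induces G) {X Z : Set V}
    (hXZ : Disjoint X Z) (x : ∀ v, D v) (u : ∀ e, M.Ω e) (v : {v // v ∉ Z}) (hv : v.1 ∉ X) :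
    (M.intervene X x).solution u v = (M.project hM Z).f v
      (fun w => (M.intervene X x).solution u w) u := by
  refine congrFun (M.eq_solution_intervene (fun w hw => ?_) fun w hw => ?_) v.1
  · exact (extend_apply Z (fun w => (M.intervene X x).solution u w) ⟨w, hw.1⟩).symm
  · refine M.solution_intervene_of_notMem x u ?_
    by_cases hwv : w = v
    · exact hwv ▸ hv
    · have : w ∈ Z := by
        by_contra hwZ
        exact hw ⟨hwZ, hwv⟩
      exact Set.disjoint_right.1 hXZ this

theorem prob_compl_eq_Q (M : CausalModel V D) {G : SMG V} (hM : M.Induces G) (Z : Set V)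
    (o : ∀ v, D v) :
    M.prob Zᶜ o = (M.project hM Z).Q Set.univ (fun v => o v) := by
  have h : ∀ u, M.solution u = (M.intervene ∅ o).solution u := fun u =>
    M.eq_solution_intervene (by simp) fun v _ => M.solution_spec u v
  rw [← (M.project hM Z).measure_solution_eq_Q (X := ∅) (by simp) (by simp) (fun v => o v)
    (fun v => o v) (fun u v => (M.intervene ∅ o).solution u v)
    (fun u v _ => M.project_f_solution hM (by simp) o u v (by simp)) (by simp) (by simp)]
  unfold prob
  simp only [h]
  congr 1
  ext u
  exact ⟨fun h v _ => h v v.2, fun h v hv => h ⟨v, hv⟩ trivial⟩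

end CausalModel

/-! ### Absence of hedges implies identifiability -/

namespace SMG

variable {V : Type} [Finite V]

/-- Soundness: without hedges, the causal effect is identifiable in the projection. -/
theorem identifiable_of_isEmpty_hedge (G : SMG V) {X Y : Set V} (hXY : Disjoint X Y)
    (h : IsEmpty (G.Hedge X Y)) : G.Identifiable Set.univ X Y := by
  intro D _ _ M₁ M₂ h₁ h₂ hP hpos x y
  refine LatentModel.effect_eq_of_isEmpty_hedge (M₁ := M₁.toLatentModel h₁)
    (M₂ := M₂.toLatentModel h₂) (fun o => ?_) (fun o => ?_) hXY h x y
    (fun u => (M₁.intervene X x).solution u)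
    (fun u v hv => M₁.solution_intervene_of_notMem x u hv)
    (fun u v hv => M₁.solution_intervene_of_mem x u hv)
    (M₁.measurableSet_solution_intervene X x)
    (fun u => (M₂.intervene X x).solution u)
    (fun u v hv => M₂.solution_intervene_of_notMem x u hv)
    (fun u v hv => M₂.solution_intervene_of_mem x u hv)
    (M₂.measurableSet_solution_intervene X x)
  · rw [← M₁.prob_univ_eq_Q h₁]; exact hpos o
  · rw [← M₁.prob_univ_eq_Q h₁, ← M₂.prob_univ_eq_Q h₂]; exact hP o

/-- The projected models need not be semi-Markovian, so identifiability in the projection cannot be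
applied to them; the argument about latent variable models can. -/
theorem identifiable_compl_of_isEmpty_hedge (G : SMG V) {X Y Z : Set V} (hXY : Disjoint X Y)
    (hXZ : Disjoint X Z) (hYZ : Disjoint Y Z)
    (h : IsEmpty ((G.latentProjection Z).Hedge {v | v.1 ∈ X} {v | v.1 ∈ Y})) :
    G.Identifiable Zᶜ X Y := by
  intro D _ _ M₁ M₂ h₁ h₂ hP hpos x y
  have hext : ∀ o : ∀ v : {v // v ∉ Z}, D v, (fun v : {v // v ∉ Z} =>
      CausalModel.extend Z o v) = o := fun o => funext fun v => CausalModel.extend_apply Z o v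
  have := LatentModel.effect_eq_of_isEmpty_hedge (M₁ := M₁.project h₁ Z)
    (M₂ := M₂.project h₂ Z) (fun o => ?_) (fun o => ?_)
    (Set.disjoint_left.2 fun v hv hv' => Set.disjoint_left.1 hXY hv hv') h
    (fun v => x v) (fun v => y v)
    (fun u v => (M₁.intervene X x).solution u v)
    (fun u v hv => M₁.project_f_solution h₁ hXZ x u v hv)
    (fun u v hv => M₁.solution_intervene_of_mem x u hv)
    (fun v => M₁.measurableSet_solution_intervene X x v)
    (fun u v => (M₂.intervene X x).solution u v)
    (fun u v hv => M₂.project_f_solution h₂ hXZ x u v hv)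
    (fun u v hv => M₂.solution_intervene_of_mem x u hv)
    (fun v => M₂.measurableSet_solution_intervene X x v)
  · have hY : ∀ a : ∀ v, D v, (∀ v ∈ Y, a v = y v) ↔
        ∀ v ∈ {v : {v // v ∉ Z} | v.1 ∈ Y}, a v = y v := fun a =>
      ⟨fun h v hv => h v hv, fun h v hv => h ⟨v, Set.disjoint_left.1 hYZ hv⟩ hv⟩
    rw [CausalModel.causalEffect_eq, CausalModel.causalEffect_eq]
    simp only [hY]
    exact this
  · rw [← hext o, ← M₁.prob_compl_eq_Q h₁]; exact hpos _
  · rw [← hext o, ← M₁.prob_compl_eq_Q h₁, ← M₂.prob_compl_eq_Q h₂]; exact hP _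

end SMG

/-! ### Boundaries of edge sets modulo 2 -/

/-- Nonempty fibres are cosets of the kernel, whose order is that of `A` divided by that of the
range. -/
theorem card_fiber_eq_of_card_range_eq {A B C : Type} [AddGroup A] [Finite A] [AddGroup B]
    [AddGroup C] (φ : A →+ B) (ψ : A →+ C) (h : Nat.card φ.range = Nat.card ψ.range) {b : B} {c : C}
    (hbc : b ∈ φ.range ↔ c ∈ ψ.range) : Nat.card {a | φ a = b} = Nat.card {a | ψ a = c} := by
  have fiber : ∀ {B' : Type} [AddGroup B'] (χ : A →+ B') (a₀ : A),
      Nat.card {a | χ a = χ a₀} = Nat.card χ.ker := by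
    intro B' _ χ a₀
    refine Nat.card_congr (Equiv.subtypeEquiv (Equiv.addRight (-a₀)) fun a => ?_)
    simp [AddMonoidHom.mem_ker, ← sub_eq_add_neg, sub_eq_zero]
  have hker : Nat.card φ.ker = Nat.card ψ.ker := by
    have h1 := φ.ker.card_mul_index
    have h2 := ψ.ker.card_mul_index
    rw [AddSubgroup.index_ker] at h1 h2
    rw [← h2, h] at h1
    have : Finite ψ.range := Finite.of_surjective ψ.rangeRestrict ψ.rangeRestrict_surjective
    exact Nat.eq_of_mul_eq_mul_right Nat.card_pos h1
  by_cases hb : b ∈ φ.range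
  · obtain ⟨a, rfl⟩ := hb
    obtain ⟨a', rfl⟩ := hbc.1 ⟨a, rfl⟩
    rw [fiber, fiber, hker]
  · have h1 : {a | φ a = b} = ∅ := Set.eq_empty_of_forall_notMem fun a ha => hb ⟨a, ha⟩
    have h2 : {a | ψ a = c} = ∅ :=
      Set.eq_empty_of_forall_notMem fun a ha => hb (hbc.2 ⟨a, ha⟩)
    simp [h1, h2]

theorem ZMod.eq_zero_or_eq_one : ∀ x : ZMod 2, x = 0 ∨ x = 1 := by decide

namespace SMG

variable {W : Type} [Fintype W] (H : SMG W)

open Classical in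
/-- The boundary, with coefficients in `ZMod 2`, of a set of bidirected edges inside `S`. -/
noncomputable def boundary (S : Set W) : (Sym2 W → ZMod 2) →+ (W → ZMod 2) where
  toFun u v := ∑ e : Sym2 W,
    if v ∈ e ∧ e ∈ H.bidirected.edgeSet ∧ ∀ w ∈ e, w ∈ S then u e else 0
  map_zero' := by ext; simp
  map_add' u u' := by
    ext v
    simp only [Pi.add_apply, ← Finset.sum_add_distrib]
    refine Finset.sum_congr rfl fun e _ => ?_
    split_ifs <;> simp

open Classical in
theorem boundary_apply (S : Set W) (u : Sym2 W → ZMod 2) (v : W) :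
    H.boundary S u v = ∑ e : Sym2 W,
      if v ∈ e ∧ e ∈ H.bidirected.edgeSet ∧ ∀ w ∈ e, w ∈ S then u e else 0 := rfl

theorem boundary_of_notMem {S : Set W} (u : Sym2 W → ZMod 2) {v : W} (hv : v ∉ S) :
    H.boundary S u v = 0 := by
  classical
  rw [boundary_apply]
  exact Finset.sum_eq_zero fun e _ => if_neg fun h => hv (h.2.2 v h.1)

open Classical in
theorem boundary_single {S : Set W} {a b : W} (ha : a ∈ S) (hb : b ∈ S)
    (hab : H.bidirected.Adj a b) :
    H.boundary S (Pi.single s(a, b) 1) = Pi.single a 1 + Pi.single b 1 := by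
  ext v
  rw [boundary_apply, Finset.sum_eq_single s(a, b)]
  · have hne : a ≠ b := hab.ne
    simp only [Sym2.mem_iff, SimpleGraph.mem_edgeSet, hab, forall_eq_or_imp, ha, forall_eq, hb,
      Pi.single_eq_same, Pi.add_apply, Pi.single_apply]
    by_cases h1 : v = a
    · subst h1; simp [hne]
    · by_cases h2 : v = b
      · subst h2; simp [hne.symm]
      · simp [h1, h2]
  · intro e _ he
    simp [he]
  · simp

/-- Each edge is counted at both of its ends. -/
theorem sum_boundary (S : Set W) (u : Sym2 W → ZMod 2) : ∑ v, H.boundary S u v = 0 := by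
  classical
  simp only [boundary_apply]
  rw [Finset.sum_comm]
  refine Finset.sum_eq_zero fun e _ => ?_
  induction e with
  | _ a b =>
  by_cases h : s(a, b) ∈ H.bidirected.edgeSet ∧ ∀ w ∈ s(a, b), w ∈ S
  · have hne : a ≠ b := H.bidirected.ne_of_adj h.1
    have : ∀ v, (if v ∈ s(a, b) ∧ s(a, b) ∈ H.bidirected.edgeSet ∧ ∀ w ∈ s(a, b), w ∈ S
        then u s(a, b) else 0) = (if v = a then u s(a, b) else 0) +
          if v = b then u s(a, b) else 0 := by
      intro v
      by_cases h1 : v = a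
      · subst h1
        rw [if_pos ⟨by simp, h⟩, if_pos rfl, if_neg hne, add_zero]
      · by_cases h2 : v = b
        · subst h2
          rw [if_pos ⟨by simp, h⟩, if_pos rfl, if_neg h1, zero_add]
        · simp [h1, h2]
    simp only [this, Finset.sum_add_distrib, Finset.sum_ite_eq', Finset.mem_univ, if_true]
    exact CharTwo.add_self_eq_zero _
  · exact Finset.sum_eq_zero fun v _ => if_neg fun h' => h h'.2

/-- The vertices that form a boundary together with a base vertex are closed under adjacency in `S`,
hence exhaust `S`. A function of total zero is a sum of such pairs, in which the base vertex
cancels. -/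
theorem mem_range_boundary {S : Set W} (hS : H.BidirectedConnected S) {g : W → ZMod 2}
    (hg : ∀ v ∉ S, g v = 0) (hsum : ∑ v, g v = 0) : g ∈ (H.boundary S).range := by
  classical
  rcases S.eq_empty_or_nonempty with rfl | ⟨a₀, ha₀⟩
  · have : g = 0 := funext fun v => hg v (by simp)
    rw [this]; exact zero_mem _
  have hself : ∀ f : W → ZMod 2, f + f = 0 := fun f =>
    funext fun v => CharTwo.add_self_eq_zero _
  let S' : Set W := {b | b ∈ S ∧ (Pi.single a₀ 1 + Pi.single b 1 : W → ZMod 2) ∈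
    (H.boundary S).range}
  have hS' : S' = S := by
    by_contra hne
    obtain ⟨a, ha, b, hb, hab⟩ := hS S' (fun b hb => hb.1)
      ⟨a₀, ha₀, by rw [hself]; exact zero_mem _⟩ hne
    refine hb.2 ⟨hb.1, ?_⟩
    have h1 := add_mem ha.2 (⟨_, H.boundary_single ha.1 hb.1 hab⟩ :
      (Pi.single a 1 + Pi.single b 1 : W → ZMod 2) ∈ (H.boundary S).range)
    have h2 : (Pi.single a₀ 1 + Pi.single a 1 + (Pi.single a 1 + Pi.single b 1) : W → ZMod 2) =
        Pi.single a₀ 1 + Pi.single b 1 := by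
      rw [add_assoc, ← add_assoc (Pi.single a 1), hself, zero_add]
    rwa [h2] at h1
  have hdecomp : g = ∑ b, (if g b = 0 then 0 else (Pi.single a₀ 1 + Pi.single b 1)) := by
    have h1 : ∀ b, (if g b = 0 then 0 else (Pi.single a₀ 1 + Pi.single b 1) : W → ZMod 2) =
        g b • (Pi.single a₀ 1) + g b • Pi.single b 1 := by
      intro b
      rcases ZMod.eq_zero_or_eq_one (g b) with h | h <;> simp [h]
    simp only [h1, Finset.sum_add_distrib, ← Finset.sum_smul, hsum, zero_smul, zero_add]
    ext v
    simp [Finset.sum_apply, Pi.single_apply]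
  rw [hdecomp]
  refine sum_mem fun b _ => ?_
  split_ifs with hb
  · exact zero_mem _
  · have hbS : b ∈ S := by
      by_contra h
      exact hb (hg b h)
    rw [← hS'] at hbS
    exact hbS.2

open Classical in
/-- The boundary in `T` at vertices outside `C`, and in `C` at vertices in `C`. -/
noncomputable def splitBoundary (C T : Set W) : (Sym2 W → ZMod 2) →+ (W → ZMod 2) where
  toFun u v := if v ∈ C then H.boundary C u v else H.boundary T u v
  map_zero' := by ext; simp
  map_add' u u' := by
    ext v
    by_cases hv : v ∈ C <;> simp [hv]

open Classical in
theorem splitBoundary_apply (C T : Set W) (u : Sym2 W → ZMod 2) (v : W) :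
    H.splitBoundary C T u v = if v ∈ C then H.boundary C u v else H.boundary T u v := rfl

open Classical in
/-- There is a set of edges inside `T` with prescribed boundary outside a nonempty subset. -/
theorem exists_boundary_eq {C T : Set W} (hC : C.Nonempty) (hCT : C ⊆ T)
    (hT : H.BidirectedConnected T) (g : W → ZMod 2) :
    ∃ u, ∀ v ∈ T, v ∉ C → H.boundary T u v = g v := by
  obtain ⟨c, hc⟩ := hC
  let g' : W → ZMod 2 := fun v => if v ∈ T ∧ v ∉ C then g v else 0
  -- The parity defect is deposited at `c`, where nothing is prescribed.
  obtain ⟨u, hu⟩ := H.mem_range_boundary hT (g := g' + (∑ v, g' v) • Pi.single c 1)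
    (fun v hv => by
      have : v ≠ c := fun h => hv (h ▸ hCT hc)
      simp [g', hv, this])
    (by simp [Finset.sum_add_distrib, ← Finset.mul_sum, CharTwo.add_self_eq_zero])
  refine ⟨u, fun v hv hvC => ?_⟩
  have : v ≠ c := fun h => hvC (h ▸ hc)
  rw [hu]
  simp [g', hv, hvC, this]

-- Edges inside `C` determine the values on `C`, and the remaining edges those on `T \ C`. The two
-- choices are independent, and only the first has a parity constraint.
open Classical in
theorem mem_range_splitBoundary_iff {C T : Set W} (hC : C.Nonempty) (hCT : C ⊆ T)
    (hC' : H.BidirectedConnected C) (hT : H.BidirectedConnected T) {g : W → ZMod 2} :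
    g ∈ (H.splitBoundary C T).range ↔ (∀ v ∉ T, g v = 0) ∧ ∑ v, (if v ∈ C then g v else 0) = 0 := by
  constructor
  · rintro ⟨u, rfl⟩
    refine ⟨fun v hv => ?_, ?_⟩
    · rw [splitBoundary_apply, if_neg fun h => hv (hCT h), H.boundary_of_notMem u hv]
    · refine Eq.trans ?_ (H.sum_boundary C u)
      refine Finset.sum_congr rfl fun v _ => ?_
      rw [splitBoundary_apply]
      by_cases hv : v ∈ C
      · simp [hv]
      · simp [hv, H.boundary_of_notMem u hv]
  · rintro ⟨h1, h2⟩
    obtain ⟨u, hu⟩ := H.mem_range_boundary hC' (g := fun v => if v ∈ C then g v else 0)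
      (fun v hv => if_neg hv) h2
    obtain ⟨u', hu'⟩ := H.exists_boundary_eq hC hCT hT g
    refine ⟨fun e => if ∀ w ∈ e, w ∈ C then u e else u' e, ?_⟩
    ext v
    rw [splitBoundary_apply]
    by_cases hv : v ∈ C
    · have h3 : H.boundary C u v = g v := (congrFun hu v).trans (if_pos hv)
      rw [if_pos hv, ← h3, boundary_apply, boundary_apply]
      refine Finset.sum_congr rfl fun e _ => ?_
      by_cases he : ∀ w ∈ e, w ∈ C
      · rw [if_pos he]
      · rw [if_neg fun h => he h.2.2, if_neg fun h => he h.2.2]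
    · rw [if_neg hv]
      by_cases hvT : v ∈ T
      · rw [← hu' v hvT hv, boundary_apply, boundary_apply]
        refine Finset.sum_congr rfl fun e _ => ?_
        by_cases he : v ∈ e
        · have : ¬ ∀ w ∈ e, w ∈ C := fun h => hv (h v he)
          simp [this]
        · simp [he]
      · rw [H.boundary_of_notMem _ hvT, h1 v hvT]

theorem mem_range_boundary_iff {T : Set W} (hT : H.BidirectedConnected T) {g : W → ZMod 2} :
    g ∈ (H.boundary T).range ↔ (∀ v ∉ T, g v = 0) ∧ ∑ v, g v = 0 := by
  constructor
  · rintro ⟨u, rfl⟩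
    exact ⟨fun v hv => H.boundary_of_notMem u hv, H.sum_boundary T u⟩
  · exact fun h => H.mem_range_boundary hT h.1 h.2

-- Both ranges are cut out by one parity condition, over all vertices or over `C` alone. Adding the
-- sum outside `C` to the coordinate at a vertex of `C` is an involution that exchanges the two
-- conditions.
open Classical in
theorem card_range_boundary_eq {C T : Set W} (hC : C.Nonempty) (hCT : C ⊆ T)
    (hC' : H.BidirectedConnected C) (hT : H.BidirectedConnected T) :
    Nat.card (H.boundary T).range = Nat.card (H.splitBoundary C T).range := by
  have hC₀ := hC
  obtain ⟨c, hc⟩ := hC₀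
  let κ : (W → ZMod 2) → (W → ZMod 2) := fun g =>
    g + (∑ v, if v ∈ C then 0 else g v) • Pi.single c 1
  have hκne : ∀ g v, v ≠ c → κ g v = g v := fun g v hv => by simp [κ, hv]
  have hκc : ∀ g, κ g c = g c + ∑ v, if v ∈ C then 0 else g v := fun g => by simp [κ]
  have hκs : ∀ g, (∑ v, if v ∈ C then 0 else κ g v) = ∑ v, if v ∈ C then 0 else g v := by
    intro g
    refine Finset.sum_congr rfl fun v _ => ?_
    by_cases hv : v ∈ C
    · simp [hv]
    · rw [if_neg hv, if_neg hv, hκne]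
      rintro rfl; exact hv hc
  have hκκ : ∀ g, κ (κ g) = g := by
    intro g
    ext v
    by_cases hv : v = c
    · subst hv
      rw [hκc, hκs, hκc, add_assoc, CharTwo.add_self_eq_zero, add_zero]
    · rw [hκne _ _ hv, hκne _ _ hv]
  have hsplit : ∀ g : W → ZMod 2, ∑ v, g v =
      (∑ v, if v ∈ C then g v else 0) + ∑ v, if v ∈ C then 0 else g v := by
    intro g
    rw [← Finset.sum_add_distrib]
    refine Finset.sum_congr rfl fun v _ => ?_
    by_cases hv : v ∈ C <;> simp [hv]
  have hκsum : ∀ g, ∑ v, κ g v = ∑ v, if v ∈ C then g v else 0 := by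
    intro g
    have : ∑ v, κ g v = ∑ v, g v + ∑ v, if v ∈ C then 0 else g v := by
      simp [κ, Finset.sum_add_distrib, ← Finset.mul_sum]
    rw [this, hsplit, add_assoc, CharTwo.add_self_eq_zero, add_zero]
  refine Nat.card_congr (Equiv.subtypeEquiv ⟨κ, κ, hκκ, hκκ⟩ fun g => ?_)
  change g ∈ _ ↔ κ g ∈ _
  rw [H.mem_range_boundary_iff hT, H.mem_range_splitBoundary_iff hC hCT hC' hT]
  refine and_congr (forall₂_congr fun v hv => ?_) ?_
  · rw [hκne]
    rintro rfl; exact hv (hCT hc)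
  · rw [← hκsum, hκκ]

-- This is what makes the parity models observationally equal: the edge bits that produce given
-- values are equally numerous in both.
open Classical in
theorem card_fiber_boundary_eq {C T : Set W} (hC : C.Nonempty) (hCT : C ⊆ T)
    (hC' : H.BidirectedConnected C) (hT : H.BidirectedConnected T) {g g' : W → ZMod 2}
    (hg : ∀ v ∉ T, g v = 0) (hg' : ∀ v ∉ T, g' v = 0)
    (h : ∑ v, g v = ∑ v, if v ∈ C then g' v else 0) :
    Nat.card {u | H.boundary T u = g} = Nat.card {u | H.splitBoundary C T u = g'} := by
  refine card_fiber_eq_of_card_range_eq _ _ (H.card_range_boundary_eq hC hCT hC' hT) ?_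
  rw [H.mem_range_boundary_iff hT, H.mem_range_splitBoundary_iff hC hCT hC' hT, h]
  exact and_congr_left fun _ => ⟨fun _ => hg', fun _ => hg⟩

end SMG

/-! ### The two parity models of a hedge -/

/-- The distribution of a bit that equals `1` with probability `ε`. -/
noncomputable def bitLaw (ε : ℝ≥0∞) : Measure (ZMod 2) :=
  (1 - ε) • Measure.dirac 0 + ε • Measure.dirac 1

theorem bitLaw_singleton_zero (ε : ℝ≥0∞) : bitLaw ε {0} = 1 - ε := by
  simp [bitLaw]

theorem bitLaw_singleton_one (ε : ℝ≥0∞) : bitLaw ε {1} = ε := by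
  simp [bitLaw]

theorem isProbabilityMeasure_bitLaw {ε : ℝ≥0∞} (hε : ε ≤ 1) : IsProbabilityMeasure (bitLaw ε) :=
  ⟨by simp [bitLaw, tsub_add_cancel_of_le hε]⟩

theorem bitLaw_half_singleton (b : ZMod 2) : bitLaw 2⁻¹ {b} = 2⁻¹ := by
  rcases ZMod.eq_zero_or_eq_one b with rfl | rfl
  · rw [bitLaw_singleton_zero, ENNReal.one_sub_inv_two]
  · rw [bitLaw_singleton_one]

namespace SMG.Hedge

variable {W : Type} {H : SMG W} {X Y : Set W} (h : H.Hedge X Y)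

open Classical in
/-- A child in `T` of each vertex in `T \ C`. -/
noncomputable def childT (v : W) : W :=
  if hv : v ∈ h.T ∧ v ∉ h.C then (h.exists_child_T v hv.1 hv.2).choose else v

open Classical in
/-- A child in `A` of each vertex in `A \ Y`. -/
noncomputable def childA (v : W) : W :=
  if hv : v ∈ h.A ∧ v ∉ Y then (h.exists_child_A v hv.1 hv.2).choose else v

theorem childT_spec {v : W} (hv : v ∈ h.T ∧ v ∉ h.C) : h.childT v ∈ h.T ∧ H.edge v (h.childT v) := by
  unfold childT
  rw [dif_pos hv]
  exact (h.exists_child_T v hv.1 hv.2).choose_spec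

theorem childA_spec {v : W} (hv : v ∈ h.A ∧ v ∉ Y) : h.childA v ∈ h.A ∧ H.edge v (h.childA v) := by
  unfold childA
  rw [dif_pos hv]
  exact (h.exists_child_A v hv.1 hv.2).choose_spec

/-- The unobserved variables of the parity models: one bit for each pair of vertices, and two
private bits for each vertex. -/
abbrev Exo (W : Type) : Type := Sym2 W ⊕ W × Bool

/-- The laws of the unobserved variables: all bits are uniform but for the noise bits. -/
noncomputable def law (W : Type) (ε : ℝ≥0∞) : Exo W → Measure (ZMod 2)
  | .inl _ => bitLaw 2⁻¹
  | .inr (_, false) => bitLaw 2⁻¹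
  | .inr (_, true) => bitLaw ε

theorem isProbabilityMeasure_law {ε : ℝ≥0∞} (hε : ε ≤ 1) (e : Exo W) :
    IsProbabilityMeasure (law W ε e) := by
  rcases e with e | ⟨v, - | -⟩
  · exact isProbabilityMeasure_bitLaw (by simp)
  · exact isProbabilityMeasure_bitLaw (by simp)
  · exact isProbabilityMeasure_bitLaw hε

variable [Fintype W]

open Classical in
/-- The sum of the first bits of the selected parents of `v` in `T`. -/
noncomputable def sumT (a : W → ZMod 2 × ZMod 2) (v : W) : ZMod 2 :=
  ∑ w, if (w ∈ h.T ∧ w ∉ h.C) ∧ h.childT w = v then (a w).1 else 0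

open Classical in
/-- The sum of the second bits of the selected parents of `v` in `A`. -/
noncomputable def sumA (a : W → ZMod 2 × ZMod 2) (v : W) : ZMod 2 :=
  ∑ w, if (w ∈ h.A ∧ w ∉ Y) ∧ h.childA w = v then (a w).2 else 0

theorem sumT_congr {a a' : W → ZMod 2 × ZMod 2} {v : W} (ha : ∀ w, H.edge w v → a w = a' w) :
    h.sumT a v = h.sumT a' v := by
  refine Finset.sum_congr rfl fun w _ => ?_
  split_ifs with hw
  · rw [ha w (hw.2 ▸ (h.childT_spec hw.1).2)]
  · rfl

theorem sumA_congr {a a' : W → ZMod 2 × ZMod 2} {v : W} (ha : ∀ w, H.edge w v → a w = a' w) :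
    h.sumA a v = h.sumA a' v := by
  refine Finset.sum_congr rfl fun w _ => ?_
  split_ifs with hw
  · rw [ha w (hw.2 ▸ (h.childA_spec hw.1).2)]
  · rfl

-- Each vertex of `T \ C` is a selected parent of exactly one vertex. This makes sums along the
-- selected edges telescope.
open Classical in
theorem sum_sumT (a : W → ZMod 2 × ZMod 2) :
    ∑ v, h.sumT a v = ∑ v, if v ∈ h.T ∧ v ∉ h.C then (a v).1 else 0 := by
  unfold sumT
  rw [Finset.sum_comm]
  refine Finset.sum_congr rfl fun w _ => ?_
  simp only [ite_and, Finset.sum_ite_irrel, Finset.sum_ite_eq, Finset.mem_univ, if_true,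
    Finset.sum_const_zero]

open Classical in
theorem sum_sumA (a : W → ZMod 2 × ZMod 2) :
    ∑ v, h.sumA a v = ∑ v, if v ∈ h.A ∧ v ∉ Y then (a v).2 else 0 := by
  unfold sumA
  rw [Finset.sum_comm]
  refine Finset.sum_congr rfl fun w _ => ?_
  simp only [ite_and, Finset.sum_ite_irrel, Finset.sum_ite_eq, Finset.mem_univ, if_true,
    Finset.sum_const_zero]

theorem sumT_of_notMem (a : W → ZMod 2 × ZMod 2) {v : W} (hv : v ∉ h.T) : h.sumT a v = 0 :=
  Finset.sum_eq_zero fun w _ => if_neg fun hw : (w ∈ h.T ∧ w ∉ h.C) ∧ h.childT w = v =>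
    hv (hw.2 ▸ (h.childT_spec hw.1).1)

theorem sumA_of_notMem (a : W → ZMod 2 × ZMod 2) {v : W} (hv : v ∉ h.A) : h.sumA a v = 0 :=
  Finset.sum_eq_zero fun w _ => if_neg fun hw : (w ∈ h.A ∧ w ∉ Y) ∧ h.childA w = v =>
    hv (hw.2 ▸ (h.childA_spec hw.1).1)

open Classical in
/-- The functions of the two parity models. The first bits of the vertices in `T \ C`, and the sums
of the selected parents that are added to the second bits of the vertices in `C`, are computed from
the boundary in `T`. In the second model, the vertices in `C` ignore everything outside `C`. -/
noncomputable def fn (i : Bool) (v : W) (a : W → ZMod 2 × ZMod 2) (u : Exo W → ZMod 2) :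
    ZMod 2 × ZMod 2 :=
  (if v ∈ h.T ∧ v ∉ h.C then h.sumT a v + H.boundary h.T (fun e => u (.inl e)) v
    else u (.inr (v, false)),
   (if v ∈ h.C then (if i then h.sumT a v + H.boundary h.T (fun e => u (.inl e)) v
      else H.boundary h.C (fun e => u (.inl e)) v) else 0) + h.sumA a v + u (.inr (v, true)))

variable (H) in
/-- The unobserved variables that enter the function of a vertex. -/
def exoOf (v : W) : Exo W → Prop
  | .inl e => v ∈ e ∧ e ∈ H.bidirected.edgeSet
  | .inr p => p.1 = v

theorem boundary_congr (S : Set W) {u u' : Exo W → ZMod 2} {v : W}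
    (hu : ∀ e, exoOf H v e → u e = u' e) :
    H.boundary S (fun e => u (.inl e)) v = H.boundary S (fun e => u' (.inl e)) v := by
  classical
  rw [boundary_apply, boundary_apply]
  refine Finset.sum_congr rfl fun e _ => ?_
  split_ifs with he
  · exact hu (.inl e) ⟨he.1, he.2.1⟩
  · rfl

open Classical in
/-- The two parity models. -/
noncomputable def parityModel {ε : ℝ≥0∞} (hε : ε ≤ 1) (i : Bool) :
    CausalModel W (fun _ => ZMod 2 × ZMod 2) where
  U := Exo W
  Ω _ := ZMod 2
  law := law W ε
  isProbabilityMeasure_law := isProbabilityMeasure_law hε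
  paV v := {w | H.edge w v}
  paU v := {e | exoOf H v e}
  f := h.fn i
  f_congr v a a' u u' ha hu := by
    unfold fn
    rw [h.sumT_congr ha, h.sumA_congr ha, boundary_congr h.T hu, boundary_congr h.C hu,
      hu (.inr (v, false)) rfl, hu (.inr (v, true)) rfl]
  measurable_f v a := fun _ _ => (Set.toFinite _).measurableSet
  acyclic := H.acyclic
  card_children e := by
    rcases e with e | p
    · induction e with
      | _ a b =>
      refine (Set.encard_le_encard (t := {a, b}) fun v hv => by simpa using hv.1).trans ?_
      refine (Set.encard_insert_le _ _).trans ?_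
      rw [Set.encard_singleton]; norm_num
    · refine (Set.encard_le_encard (t := {p.1}) fun v hv => ?_).trans (by simp)
      exact hv.symm

theorem induces_parityModel {ε : ℝ≥0∞} (hε : ε ≤ 1) (i : Bool) :
    (h.parityModel hε i).Induces H := by
  refine ⟨fun a b => Iff.rfl, fun a b => ⟨fun hab => ⟨hab.ne, .inl s(a, b), ?_, ?_⟩, ?_⟩⟩
  · exact ⟨by simp, hab⟩
  · exact ⟨by simp, hab⟩
  · rintro ⟨hne, e | p, ha, hb⟩
    · obtain ⟨ha, he⟩ := ha
      have hb : b ∈ e := hb.1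
      obtain rfl := (Sym2.mem_and_mem_iff hne).1 ⟨ha, hb⟩
      exact he
    · exact absurd (ha.symm.trans hb) hne

instance : Fintype (Exo W) := by
  classical
  infer_instance

theorem pi_law_singleton_pos {ε : ℝ≥0∞} (hε : ε ≤ 2⁻¹) (hε₀ : 0 < ε) (u : Exo W → ZMod 2) :
    (2⁻¹ : ℝ≥0∞) ≤ 1 - ε ∧ 0 < Measure.pi (law W ε) {u} := by
  have h1 : (2⁻¹ : ℝ≥0∞) ≤ 1 - ε := by
    rw [← ENNReal.one_sub_inv_two]
    exact tsub_le_tsub_left hε 1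
  refine ⟨h1, ?_⟩
  have := isProbabilityMeasure_law (W := W) (hε.trans (by simp))
  rw [Measure.pi_singleton]
  refine pos_iff_ne_zero.2 (Finset.prod_ne_zero_iff.2 fun e _ => ?_)
  rcases e with e | ⟨v, - | -⟩
  · simp [law, bitLaw_half_singleton]
  · simp [law, bitLaw_half_singleton]
  · change bitLaw ε _ ≠ 0
    rcases ZMod.eq_zero_or_eq_one (u (.inr (v, true))) with hb | hb <;> rw [hb]
    · rw [bitLaw_singleton_zero]
      exact (lt_of_lt_of_le (by simp) h1).ne'
    · rw [bitLaw_singleton_one]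
      exact hε₀.ne'

/-- The private bits `r` are compatible with the observed values `o`. -/
def Compatible (o : W → ZMod 2 × ZMod 2) (r : W × Bool → ZMod 2) : Prop :=
  (∀ v, ¬ (v ∈ h.T ∧ v ∉ h.C) → r (v, false) = (o v).1) ∧
    ∀ v ∉ h.C, (o v).2 = h.sumA o v + r (v, true)

open Classical in
/-- The values of the parity functions determine the boundaries. -/
theorem forall_fn_eq_iff (i : Bool) (o : W → ZMod 2 × ZMod 2) (u : Sym2 W → ZMod 2)
    (r : W × Bool → ZMod 2) :
    (∀ v, h.fn i v o (Sum.elim u r) = o v) ↔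
      h.Compatible o r ∧ (if i then H.boundary h.T u else H.splitBoundary h.C h.T u) =
        fun v => if v ∈ h.C then
          (o v).2 - h.sumA o v - r (v, true) - (if i then h.sumT o v else 0)
        else if v ∈ h.T then (o v).1 - h.sumT o v else 0 := by
  rw [Compatible, funext_iff, ← forall_and, ← forall_and]
  refine forall_congr' fun v => ?_
  simp only [fn, Prod.ext_iff, Sum.elim_inl, Sum.elim_inr]
  by_cases hC : v ∈ h.C
  · cases i
    · simp only [hC, not_true_eq_false, and_false, if_false, if_true, Bool.false_eq_true,
        splitBoundary_apply, IsEmpty.forall_iff, forall_const, not_false_eq_true, and_true]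
      exact and_congr_right fun _ => ⟨fun h => by linear_combination h,
        fun h => by linear_combination h⟩
    · simp only [hC, not_true_eq_false, and_false, if_false, if_true,
        IsEmpty.forall_iff, forall_const, not_false_eq_true, and_true]
      exact and_congr_right fun _ => ⟨fun h => by linear_combination h,
        fun h => by linear_combination h⟩
  · have hb : (if i then H.boundary h.T u else H.splitBoundary h.C h.T u) v =
        H.boundary h.T u v := by
      cases i <;> simp [splitBoundary_apply, hC]
    rw [hb]
    by_cases hT : v ∈ h.T
    · simp only [hC, hT, not_false_eq_true, and_true, if_true, if_false, not_true_eq_false,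
        IsEmpty.forall_iff, forall_const, true_and, zero_add]
      exact ⟨fun h => ⟨h.2.symm, by linear_combination h.1⟩,
        fun h => ⟨by linear_combination h.2, h.1.symm⟩⟩
    · simp only [hC, hT, not_false_eq_true, if_false, forall_const, zero_add,
        H.boundary_of_notMem u hT, and_true]
      exact and_congr_right fun _ => eq_comm

-- The edge bits are uniform, so for fixed private bits an event weighs as much as its number of
-- edge configurations.
open Classical in
theorem pi_law_eq_of_card_eq {ε : ℝ≥0∞} (hε : ε ≤ 1) {S S' : Set (Exo W → ZMod 2)}
    (hS : ∀ r, Nat.card {u : Sym2 W → ZMod 2 | Sum.elim u r ∈ S} =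
      Nat.card {u : Sym2 W → ZMod 2 | Sum.elim u r ∈ S'}) :
    Measure.pi (law W ε) S = Measure.pi (law W ε) S' := by
  have := isProbabilityMeasure_law (W := W) hε
  let c : (W × Bool → ZMod 2) → ℝ≥0∞ := fun r => Measure.pi (law W ε) {Sum.elim (fun _ => 0) r}
  have hc : ∀ r u, Measure.pi (law W ε) {Sum.elim u r} = c r := by
    intro r u
    simp only [c, Measure.pi_singleton, Fintype.prod_sum_type, Sum.elim_inl, Sum.elim_inr]
    congr 1
    simp [law, bitLaw_half_singleton]
  have hpi : ∀ S : Set (Exo W → ZMod 2), Measure.pi (law W ε) S =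
      ∑ r : W × Bool → ZMod 2, Nat.card {u : Sym2 W → ZMod 2 | Sum.elim u r ∈ S} * c r := by
    intro S
    rw [← lintegral_indicator_one (Set.toFinite S).measurableSet, lintegral_fintype,
      ← (Equiv.sumArrowEquivProdArrow _ _ _).symm.sum_comp, Fintype.sum_prod_type_right]
    refine Finset.sum_congr rfl fun r _ => ?_
    have : ∀ u : Sym2 W → ZMod 2, (Equiv.sumArrowEquivProdArrow _ _ _).symm (u, r) =
        Sum.elim u r := fun u => rfl
    simp only [this, hc, ← Finset.sum_mul]
    congr 1
    simp [Set.indicator_apply, Nat.card_eq_fintype_card, Fintype.card_subtype]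
  rw [hpi, hpi]
  exact Finset.sum_congr rfl fun r _ => by rw [hS r]

open Classical in
theorem prob_parityModel_eq {ε : ℝ≥0∞} (hε : ε ≤ 1) (o : W → ZMod 2 × ZMod 2) :
    (h.parityModel hε true).prob Set.univ o = (h.parityModel hε false).prob Set.univ o := by
  rw [CausalModel.prob_univ_eq_Q _ (h.induces_parityModel hε true),
    CausalModel.prob_univ_eq_Q _ (h.induces_parityModel hε false)]
  refine pi_law_eq_of_card_eq hε fun r => ?_
  have hmem : ∀ i (u : Sym2 W → ZMod 2), (Sum.elim u r ∈ {u | ∀ v ∈ Set.univ,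
      h.fn i v o u = o v}) ↔ ∀ v, h.fn i v o (Sum.elim u r) = o v := fun i u => by simp
  change Nat.card {u : Sym2 W → ZMod 2 | Sum.elim u r ∈ {u | ∀ v ∈ Set.univ,
    h.fn true v o u = o v}} = Nat.card {u : Sym2 W → ZMod 2 | Sum.elim u r ∈ {u | ∀ v ∈ Set.univ,
    h.fn false v o u = o v}}
  simp only [hmem, forall_fn_eq_iff]
  by_cases hr : h.Compatible o r
  · simp only [hr, true_and, Bool.false_eq_true, if_true, if_false, sub_zero]
    refine H.card_fiber_boundary_eq h.nonempty_C h.C_subset_T h.connected_C h.connected_T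
      (fun v hv => ?_) (fun v hv => ?_) ?_
    · rw [if_neg fun hC => hv (h.C_subset_T hC), if_neg hv]
    · rw [if_neg fun hC => hv (h.C_subset_T hC), if_neg hv]
    -- The contributions of selected parents cancel against the first bits on `T \ C`, so the total
    -- in the first model is the total over `C` in the second.
    · have hval : ∀ v, (if v ∈ h.C then (o v).2 - h.sumA o v - r (v, true) - h.sumT o v
          else if v ∈ h.T then (o v).1 - h.sumT o v else 0) =
          (if v ∈ h.C then (o v).2 - h.sumA o v - r (v, true) else 0) +
            ((if v ∈ h.T ∧ v ∉ h.C then (o v).1 else 0) - h.sumT o v) := by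
        intro v
        by_cases hC : v ∈ h.C
        · simp only [hC, if_true, not_true_eq_false, and_false, if_false]
          ring
        · by_cases hT : v ∈ h.T
          · simp [hC, hT]
          · simp [hC, hT, h.sumT_of_notMem o hT]
      simp only [hval, Finset.sum_add_distrib, Finset.sum_sub_distrib, h.sum_sumT, sub_self,
        add_zero]
      refine Finset.sum_congr rfl fun v _ => ?_
      split_ifs <;> rfl
  · simp [hr]

theorem prob_parityModel_pos {ε : ℝ≥0∞} (hε : ε ≤ 1) (hε' : ε ≤ 2⁻¹) (hε₀ : 0 < ε)
    (o : W → ZMod 2 × ZMod 2) : 0 < (h.parityModel hε true).prob Set.univ o := by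
  classical
  rw [CausalModel.prob_univ_eq_Q _ (h.induces_parityModel hε true)]
  obtain ⟨u, hu⟩ := H.exists_boundary_eq h.nonempty_C h.C_subset_T h.connected_T
    fun v => (o v).1 - h.sumT o v
  -- The edge bits already give the first bits on `T \ C`. Every other observed bit has a private
  -- bit of its own that can correct it.
  let r : W × Bool → ZMod 2 := fun p => if p.2 then (o p.1).2 - h.sumA o p.1 -
    (if p.1 ∈ h.C then h.sumT o p.1 + H.boundary h.T u p.1 else 0) else (o p.1).1
  refine (pi_law_singleton_pos hε' hε₀ (Sum.elim u r)).2.trans_le (measure_mono ?_)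
  rintro _ rfl v -
  change h.fn true v o (Sum.elim u r) = o v
  refine Prod.ext ?_ ?_
  · by_cases hv : v ∈ h.T ∧ v ∉ h.C
    · simp [fn, hv, hu v hv.1 hv.2]
    · simp [fn, hv, r]
  · simp [fn, r]
    ring

open Classical in
/-- The second bits of the elements of `Y` sum up to the inputs at the elements of `C` and the noise
at the elements of `A`. -/
theorem sum_snd_eq (a : W → ZMod 2 × ZMod 2) (b c : W → ZMod 2)
    (ha : ∀ v ∈ h.A, (a v).2 = (if v ∈ h.C then b v else 0) + h.sumA a v + c v) :
    (∑ v, if v ∈ h.A ∧ v ∈ Y then (a v).2 else 0) =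
      (∑ v, if v ∈ h.C then b v else 0) + ∑ v, if v ∈ h.A then c v else 0 := by
  have hval : ∀ v, (if v ∈ h.A ∧ v ∈ Y then (a v).2 else 0) =
      ((if v ∈ h.C then b v else 0) + if v ∈ h.A then c v else 0) +
        (h.sumA a v - if v ∈ h.A ∧ v ∉ Y then (a v).2 else 0) := by
    intro v
    by_cases hA : v ∈ h.A
    · by_cases hY : v ∈ Y
      · simp [hA, hY, ha v hA]; ring
      · simp [hA, hY, ha v hA]; ring
    · have hC : v ∉ h.C := fun hC => hA (h.C_subset_A hC)
      simp [hA, hC, h.sumA_of_notMem a hA]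
  simp only [hval, Finset.sum_add_distrib, Finset.sum_sub_distrib, h.sum_sumA, sub_self, add_zero]

open Classical in
/-- Switching on a single intervened first bit, from which no other element of `X` can be reached in
`T`, switches the sum of the inputs at the elements of `C`. -/
theorem sum_sumT_eq_one (a : W → ZMod 2 × ZMod 2) {t : W} (ht : t ∈ h.T ∩ X)
    (hmax : ∀ v ∈ h.T ∩ X, ¬ Relation.TransGen H.edge t v)
    (haX : ∀ v ∈ X, (a v).1 = if v = t then 1 else 0)
    (ha : ∀ v ∈ h.T, v ∉ h.C → v ∉ X → (a v).1 = h.sumT a v) :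
    (∑ v, if v ∈ h.C then h.sumT a v else 0) = 1 := by
  have hCX : ∀ v ∈ h.C, v ∉ X := fun v hv => Set.disjoint_left.1 h.disjoint (h.C_subset_A hv)
  have htC : t ∉ h.C := fun hC => hCX t hC ht.2
  -- With no noise, a nonzero first bit can be traced back to `t`. By the choice of `t`, no signal
  -- then arrives at `T ∩ X`, so none is absorbed by the intervention.
  have hreach : ∀ v, v ∈ h.T → v ∉ h.C → (a v).1 ≠ 0 → Relation.ReflTransGen H.edge t v := by
    intro v
    induction v using H.wellFounded_edge.induction with
    | _ v ih =>
    intro hT hC hv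
    by_cases hX : v ∈ X
    · rw [haX v hX] at hv
      obtain rfl : v = t := by
        by_contra hne
        simp [hne] at hv
      exact .refl
    · rw [ha v hT hC hX] at hv
      obtain ⟨w, -, hw⟩ := Finset.exists_ne_zero_of_sum_ne_zero hv
      have hw' : (w ∈ h.T ∧ w ∉ h.C) ∧ h.childT w = v := by
        by_contra hno
        exact hw (if_neg hno)
      rw [if_pos hw'] at hw
      have hwv : H.edge w v := hw'.2 ▸ (h.childT_spec hw'.1).2
      exact (ih w hwv hw'.1.1 hw'.1.2 hw).tail hwv
  have hzero : ∀ v ∈ h.T ∩ X, h.sumT a v = 0 := by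
    intro v hv
    refine Finset.sum_eq_zero fun w _ => ?_
    split_ifs with hw
    · by_contra hne
      exact hmax v hv (.tail' (hreach w hw.1.1 hw.1.2 hne) (hw.2 ▸ (h.childT_spec hw.1).2))
    · rfl
  have hsum := h.sum_sumT a
  have hval : ∀ v, (if v ∈ h.T ∧ v ∉ h.C then (a v).1 else 0) =
      (h.sumT a v - if v ∈ h.C then h.sumT a v else 0) + if v = t then 1 else 0 := by
    intro v
    by_cases hT : v ∈ h.T
    · by_cases hC : v ∈ h.C
      · have : v ≠ t := fun h => htC (h ▸ hC)
        simp [hT, hC, this]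
      · by_cases hX : v ∈ X
        · simp [hT, hC, haX v hX, hzero v ⟨hT, hX⟩]
        · have : v ≠ t := fun h => hX (h ▸ ht.2)
          simp [hT, hC, ha v hT hC hX, this]
    · have h1 : v ∉ h.C := fun hC => hT (h.C_subset_T hC)
      have h2 : v ≠ t := fun h => hT (h ▸ ht.1)
      simp [hT, h1, h2, h.sumT_of_notMem a hT]
  simp only [hval, Finset.sum_add_distrib, Finset.sum_sub_distrib, Finset.sum_ite_eq',
    Finset.mem_univ, if_true] at hsum
  linear_combination hsum

open Classical in
/-- The parity models have different causal effects. -/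
theorem exists_causalEffect_parityModel_ne {ε : ℝ≥0∞} (hε : ε ≤ 1) (hε' : ε ≤ 2⁻¹)
    (hεW : Fintype.card W * ε < 2⁻¹ ^ Fintype.card (Exo W)) :
    ∃ x y, (h.parityModel hε true).causalEffect X x Y y ≠
      (h.parityModel hε false).causalEffect X x Y y := by
  obtain ⟨t, ht, hmax⟩ := H.wellFounded_swap_transGen.has_min _ h.nonempty_TX
  let x : W → ZMod 2 × ZMod 2 := fun v => (if v = t then 1 else 0, 0)
  by_contra! heq
  have hprob := isProbabilityMeasure_law (W := W) hε
  let s : Bool → (Exo W → ZMod 2) → W → ZMod 2 × ZMod 2 := fun i u =>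
    ((h.parityModel hε i).intervene X x).solution u
  have hsX : ∀ i u, ∀ v ∈ X, s i u v = x v := fun i u v hv =>
    (h.parityModel hε i).solution_intervene_of_mem x u hv
  have hs : ∀ i u, ∀ v ∉ X, s i u v = h.fn i v (s i u) u := fun i u v hv =>
    (h.parityModel hε i).solution_intervene_of_notMem x u hv
  -- The distinguishing event is odd parity of the second bits on `A ∩ Y`. In the first model it
  -- occurs when all unobserved bits vanish. In the second the edges inside `C` cancel, so it
  -- requires a noise bit, which is too unlikely.
  let R : (W → ZMod 2 × ZMod 2) → Prop := fun a =>
    (∑ v, if v ∈ h.A ∧ v ∈ Y then (a v).2 else 0) = 1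
  have hR := measure_eq_of_forall_cylinder (Measure.pi (law W ε)) (Measure.pi (law W ε))
    (s true) (s false) (fun _ _ => (Set.toFinite _).measurableSet)
    (fun _ _ => (Set.toFinite _).measurableSet) Y (fun y => heq x y) R (by
      intro a b hab ha
      refine Eq.trans (Finset.sum_congr rfl fun v _ => ?_) ha
      split_ifs with hv
      · rw [hab v hv.2]
      · rfl)
  have hAX : ∀ v ∈ h.A, v ∉ X := fun v hv => Set.disjoint_left.1 h.disjoint hv
  have hsnd : ∀ i u, (∑ v, if v ∈ h.A ∧ v ∈ Y then (s i u v).2 else 0) =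
      (∑ v, if v ∈ h.C then (if i then h.sumT (s i u) v + H.boundary h.T (fun e => u (.inl e)) v
        else H.boundary h.C (fun e => u (.inl e)) v) else 0) +
        ∑ v, if v ∈ h.A then u (.inr (v, true)) else 0 := by
    intro i u
    refine h.sum_snd_eq (s i u) _ (fun v => u (.inr (v, true))) fun v hv => ?_
    exact congrArg Prod.snd (hs i u v (hAX v hv))
  have h1 : {0} ⊆ {u | R (s true u)} := by
    rintro _ rfl
    change _ = _
    rw [hsnd]
    have hb : H.boundary h.T (fun _ => 0) = 0 :=
      map_zero (H.boundary h.T)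
    simp only [if_true, Pi.zero_apply, hb, add_zero, ite_self, Finset.sum_const_zero]
    refine h.sum_sumT_eq_one (s true 0) ht hmax (fun v hv => by rw [hsX true 0 v hv]) fun v hT hC hX => ?_
    rw [hs true 0 v hX]
    simp [fn, hT, hC, hb]
  have h2 : {u | R (s false u)} ⊆ ⋃ v : W, {u | u (.inr (v, true)) = 1} := by
    intro u hu
    by_contra hno
    simp only [Set.mem_iUnion, Set.mem_ofPred_eq, not_exists] at hno
    have hno' : ∀ v, u (.inr (v, true)) = 0 := fun v =>
      (ZMod.eq_zero_or_eq_one _).resolve_right (hno v)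
    have hu' : _ = _ := hu
    rw [hsnd] at hu'
    simp only [Bool.false_eq_true, if_false, hno', ite_self, Finset.sum_const_zero,
      add_zero] at hu'
    refine zero_ne_one (Eq.trans ?_ hu')
    refine (H.sum_boundary h.C (fun e => u (.inl e))).symm.trans ?_
    refine Finset.sum_congr rfl fun v _ => ?_
    split_ifs with hv
    · rfl
    · exact H.boundary_of_notMem _ hv
  have h3 : (2⁻¹ : ℝ≥0∞) ^ Fintype.card (Exo W) ≤ Measure.pi (law W ε) {0} := by
    rw [Measure.pi_singleton, ← Finset.card_univ, ← Finset.prod_const]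
    refine Finset.prod_le_prod' fun e _ => ?_
    rcases e with e | ⟨v, - | -⟩
    · simp [law, bitLaw_half_singleton]
    · simp [law, bitLaw_half_singleton]
    · change _ ≤ bitLaw ε {0}
      rw [bitLaw_singleton_zero, ← ENNReal.one_sub_inv_two]
      exact tsub_le_tsub_left hε' 1
  have h4 : Measure.pi (law W ε) (⋃ v : W, {u | u (.inr (v, true)) = 1}) ≤
      Fintype.card W * ε := by
    refine (measure_iUnion_fintype_le _ _).trans ?_
    have : ∀ v : W, Measure.pi (law W ε) {u | u (.inr (v, true)) = 1} = ε := by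
      intro v
      have := (measurePreserving_eval (law W ε) (.inr (v, true))).measure_preimage
        (s := {1}) (measurableSet_singleton _).nullMeasurableSet
      exact this.trans (bitLaw_singleton_one ε)
    simp [this]
  exact absurd (((h3.trans (measure_mono h1)).trans hR.le).trans ((measure_mono h2).trans h4))
    (not_le.2 hεW)

end SMG.Hedge

/-- If there is a hedge, then there are two models with finitely many values of the unobserved
variables that agree on the observed distribution and have different causal effects. -/
theorem SMG.Hedge.exists_models {W : Type} [Finite W] {H : SMG W} {X Y : Set W}
    (h : H.Hedge X Y) : ∃ M₁ M₂ : CausalModel W (fun _ => ZMod 2 × ZMod 2),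
      ((M₁.Induces H ∧ (∀ e, Finite (M₁.Ω e)) ∧ ∀ e, MeasurableSingletonClass (M₁.Ω e)) ∧
        (M₂.Induces H ∧ (∀ e, Finite (M₂.Ω e)) ∧ ∀ e, MeasurableSingletonClass (M₂.Ω e))) ∧
      (∀ o, M₁.prob Set.univ o = M₂.prob Set.univ o) ∧ (∀ o, 0 < M₁.prob Set.univ o) ∧
      ∃ x y, M₁.causalEffect X x Y y ≠ M₂.causalEffect X x Y y := by
  have := Fintype.ofFinite W
  -- The noise must be positive for full support, yet its union bound must stay below the
  -- probability that all unobserved bits vanish.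
  obtain ⟨ε, hε₀, hε⟩ := ENNReal.exists_nnreal_pos_mul_lt (a := Fintype.card W)
    (b := 2⁻¹ ^ Fintype.card (Exo W)) (by simp) (by simp)
  have h1 : (min (ε : ℝ≥0∞) 2⁻¹) ≤ 2⁻¹ := min_le_right _ _
  have h2 : (min (ε : ℝ≥0∞) 2⁻¹) ≤ 1 := h1.trans (by simp)
  have h3 : 0 < (min (ε : ℝ≥0∞) 2⁻¹) := lt_min (by simpa using hε₀) (by simp)
  refine ⟨h.parityModel h2 true, h.parityModel h2 false, ⟨⟨h.induces_parityModel h2 true, ?_, ?_⟩,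
    ⟨h.induces_parityModel h2 false, ?_, ?_⟩⟩, h.prob_parityModel_eq h2,
    h.prob_parityModel_pos h2 h1 h3, h.exists_causalEffect_parityModel_ne h2 h1 ?_⟩
  · exact fun _ => inferInstanceAs (Finite (ZMod 2))
  · exact fun _ => inferInstanceAs (MeasurableSingletonClass (ZMod 2))
  · exact fun _ => inferInstanceAs (Finite (ZMod 2))
  · exact fun _ => inferInstanceAs (MeasurableSingletonClass (ZMod 2))
  · refine lt_of_le_of_lt ?_ hε
    rw [mul_comm]
    exact mul_le_mul_left (min_le_left _ _) _

theorem SMG.Hedge.not_identifiable {W : Type} [Finite W] {H : SMG W} {X Y : Set W}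
    (h : H.Hedge X Y) : ¬ H.Identifiable Set.univ X Y := by
  obtain ⟨M₁, M₂, ⟨h₁, h₂⟩, hP, hpos, x, y, hne⟩ := h.exists_models
  exact fun hI => hne (hI _ M₁ M₂ h₁.1 h₂.1 hP hpos x y)

/-! ### Simulating a model of the projection in the original graph -/

theorem measurePreserving_comp_inl {ι ι' : Type} [Fintype ι] [Fintype ι'] {Ω : ι ⊕ ι' → Type}
    [∀ e, MeasurableSpace (Ω e)] (law : ∀ e, Measure (Ω e)) [∀ e, IsProbabilityMeasure (law e)] :
    MeasurePreserving (fun (u : ∀ e, Ω e) (e : ι) => u (.inl e)) (Measure.pi law)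
      (Measure.pi fun e => law (.inl e)) :=
  measurePreserving_fst.comp (measurePreserving_sumPiEquivProdPi law)

namespace CausalModel

variable {V : Type} {D' : V → Type} {G : SMG V} {Z : Set V} {D : {v // v ∉ Z} → Type}

/-- An unobserved variable of a model of the latent projection can be placed at one or two vertices
of the original graph from which it reaches its children through latent vertices. -/
theorem exists_apex [Finite V] (M : CausalModel {v // v ∉ Z} D)
    (hM : M.Induces (G.latentProjection Z)) (e : M.U) :
    ∃ s : Set V, s.encard ≤ 2 ∧ (∀ a ∈ s, ∀ b ∈ s, a ≠ b → G.bidirected.Adj a b) ∧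
      ∀ v, e ∈ M.paU v → ∃ w ∈ s, G.LatentAnc Zᶜ w v := by
  have hsing : ∀ z : V, ({z} : Set V).encard ≤ 2 ∧
      ∀ a ∈ ({z} : Set V), ∀ b ∈ ({z} : Set V), a ≠ b → G.bidirected.Adj a b := by
    refine fun z => ⟨by simp, ?_⟩
    rintro a rfl b rfl h
    exact absurd rfl h
  by_cases h2 : ∃ a b, a ≠ b ∧ e ∈ M.paU a ∧ e ∈ M.paU b
  · obtain ⟨a, b, hab, ha, hb⟩ := h2
    have honly : ∀ v, e ∈ M.paU v → v = a ∨ v = b := by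
      intro v hv
      by_contra! hne
      have h3 : ({v, a, b} : Set {v // v ∉ Z}).encard ≤ 2 := by
        refine (Set.encard_le_encard ?_).trans (M.card_children e)
        rintro _ (rfl | rfl | rfl) <;> assumption
      rw [Set.encard_insert_of_notMem (by simp [hne.1, hne.2]), Set.encard_pair hab] at h3
      exact absurd h3 (by norm_num)
    obtain ⟨-, ⟨z, hz, hza, hzb⟩ | ⟨s, w, hw, w', hw', hwa, hwb⟩⟩ :=
      SMG.latentProjection_adj.1 ((hM.2 a b).2 ⟨hab, e, ha, hb⟩)
    · refine ⟨{z}, (hsing z).1, (hsing z).2, fun v hv => ⟨z, rfl, ?_⟩⟩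
      rcases honly v hv with rfl | rfl <;> assumption
    · obtain ⟨s, hs⟩ := s
      induction s with
      | _ p q =>
      refine ⟨{p, q}, ?_, ?_, fun v hv => ?_⟩
      · refine (Set.encard_insert_le _ _).trans ?_
        rw [Set.encard_singleton]; norm_num
      · rintro c (rfl | rfl) d (rfl | rfl) hcd
        · exact absurd rfl hcd
        · exact hs
        · exact hs.symm
        · exact absurd rfl hcd
      · rcases honly v hv with rfl | rfl
        · exact ⟨w, by simpa using hw, hwa⟩
        · exact ⟨w', by simpa using hw', hwb⟩
  · by_cases h1 : ∃ a, e ∈ M.paU a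
    · obtain ⟨a, ha⟩ := h1
      refine ⟨{a.1}, (hsing a).1, (hsing a).2, fun v hv => ⟨a, rfl, ?_⟩⟩
      obtain rfl : a = v := by
        by_contra hne
        exact h2 ⟨a, v, hne, ha, hv⟩
      exact .refl
    · exact ⟨∅, by simp, by simp, fun v hv => absurd ⟨v, hv⟩ h1⟩

open Classical in
/-- The domains of the variables of a model of `G` that simulates a model of a latent projection:
the variables in `Z` take values in `C`. -/
def LiftDom (D : {v // v ∉ Z} → Type) (C : Type) (v : V) : Type :=
  if h : v ∈ Z then C else D ⟨v, h⟩

/-- The values of a variable in `Z` in a simulating model. -/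
noncomputable def liftDomLatent (D : {v // v ∉ Z} → Type) (C : Type) {v : V} (h : v ∈ Z) :
    LiftDom D C v ≃ C := Equiv.cast (dif_pos h)

/-- The values of a variable outside `Z` in a simulating model. -/
noncomputable def liftDomObserved (D : {v // v ∉ Z} → Type) (C : Type) (v : {v // v ∉ Z}) :
    LiftDom D C v ≃ D v := Equiv.cast (dif_neg v.2)

instance {C : Type} [Finite C] [∀ v, Finite (D v)] (v : V) : Finite (LiftDom D C v) := by
  by_cases h : v ∈ Z
  · exact Finite.of_equiv _ (liftDomLatent D C h).symm
  · exact Finite.of_equiv _ (liftDomObserved D C ⟨v, h⟩).symm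

instance {C : Type} [Nonempty C] [∀ v, Nonempty (D v)] (v : V) : Nonempty (LiftDom D C v) := by
  by_cases h : v ∈ Z
  · exact (liftDomLatent D C h).nonempty
  · exact (liftDomObserved D C ⟨v, h⟩).nonempty

section lift

variable {E C : Type} {Ω : E → Type}

variable (G) in
open Classical in
/-- The value of the observed variable `b`, as transmitted to `v`, possibly through `Z`. -/
noncomputable def transmitted [∀ v, Nonempty (D v)] (get : C → (∀ v, D v) × (∀ e, Ω e)) (v : V)
    (a : ∀ v, LiftDom D C v) (b : {v // v ∉ Z}) : D b :=
  if G.edge b v then liftDomObserved D C b (a b)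
  else if h : ∃ z, z ∈ Z ∧ G.edge z v ∧ ∃ w, G.edge b w ∧ G.LatentAnc Zᶜ w z then
    (get (liftDomLatent D C h.choose_spec.1 (a h.choose))).1 b
  else Classical.arbitrary _

variable (G) in
open Classical in
/-- The value of the unobserved variable `e`, as transmitted to `v`, possibly through `Z`. -/
noncomputable def transmittedExo [∀ e, Nonempty (Ω e)] (get : C → (∀ v, D v) × (∀ e, Ω e))
    (apex : E → Set V) (v : V)
    (a : ∀ v, LiftDom D C v) (u : ∀ e, Ω e) (e : E) : Ω e :=
  if v ∈ apex e then u e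
  else if h : ∃ z, z ∈ Z ∧ G.edge z v ∧ ∃ w ∈ apex e, G.LatentAnc Zᶜ w z then
    (get (liftDomLatent D C h.choose_spec.1 (a h.choose))).2 e
  else Classical.arbitrary _

theorem transmitted_congr [∀ v, Nonempty (D v)] (get : C → (∀ v, D v) × (∀ e, Ω e)) {v : V}
    {a a' : ∀ v, LiftDom D C v} (ha : ∀ w, G.edge w v → a w = a' w) :
    transmitted G get v a = transmitted G get v a' := by
  funext b
  unfold transmitted
  split_ifs with h1 h2
  · rw [ha b h1]
  · rw [ha _ h2.choose_spec.2.1]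
  · rfl

theorem transmittedExo_congr [∀ e, Nonempty (Ω e)] (get : C → (∀ v, D v) × (∀ e, Ω e))
    (apex : E → Set V) {v : V}
    {a a' : ∀ v, LiftDom D C v} {u u' : ∀ e, Ω e} (ha : ∀ w, G.edge w v → a w = a' w)
    (hu : ∀ e, v ∈ apex e → u e = u' e) :
    transmittedExo G get apex v a u = transmittedExo G get apex v a' u' := by
  funext e
  unfold transmittedExo
  split_ifs with h1 h2
  · exact hu e h1
  · rw [ha _ h2.choose_spec.2.1]
  · rfl

/-- A latent path from a child of `b` to `v` is trivial or arrives through a parent in `Z`, so the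
default value is never used. Any choice of that parent will do, as all of them carry the correct
value. -/
theorem transmitted_eq [∀ v, Nonempty (D v)] {get : C → (∀ v, D v) × (∀ e, Ω e)} {v : V}
    {a : ∀ v, LiftDom D C v}
    {b : {v // v ∉ Z}} (hb : ∃ w, G.edge b w ∧ G.LatentAnc Zᶜ w v)
    (hz : ∀ z (h : z ∈ Z), G.edge z v → (∃ w, G.edge b w ∧ G.LatentAnc Zᶜ w z) →
      (get (liftDomLatent D C h (a z))).1 b = liftDomObserved D C b (a b)) :
    transmitted G get v a b = liftDomObserved D C b (a b) := by
  unfold transmitted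
  split_ifs with h1 h2
  · rfl
  · exact hz _ _ h2.choose_spec.2.1 h2.choose_spec.2.2
  · obtain ⟨w, hbw, hwv⟩ := hb
    rcases Relation.ReflTransGen.cases_tail hwv with rfl | ⟨z, hwz, hz, hzv⟩
    · exact absurd hbw h1
    · exact absurd ⟨z, not_not.1 hz, hzv, w, hbw, hwz⟩ h2

theorem transmittedExo_eq [∀ e, Nonempty (Ω e)] {get : C → (∀ v, D v) × (∀ e, Ω e)}
    {apex : E → Set V} {v : V}
    {a : ∀ v, LiftDom D C v} {u : ∀ e, Ω e} {e : E} (he : ∃ w ∈ apex e, G.LatentAnc Zᶜ w v)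
    (hz : ∀ z (h : z ∈ Z), G.edge z v → (∃ w ∈ apex e, G.LatentAnc Zᶜ w z) →
      (get (liftDomLatent D C h (a z))).2 e = u e) :
    transmittedExo G get apex v a u e = u e := by
  unfold transmittedExo
  split_ifs with h1 h2
  · rfl
  · exact hz _ _ h2.choose_spec.2.1 h2.choose_spec.2.2
  · obtain ⟨w, hew, hwv⟩ := he
    rcases Relation.ReflTransGen.cases_tail hwv with rfl | ⟨z, hwz, hz, hzv⟩
    · exact absurd hew h1
    · exact absurd ⟨z, not_not.1 hz, hzv, w, hew, hwz⟩ h2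

end lift

instance {E F : Type} {Ω : E → Type} [i : ∀ e, MeasurableSpace (Ω e)] (e : E ⊕ F) :
    MeasurableSpace (Sum.elim Ω (fun _ => Unit) e) :=
  match e with
  | .inl e => i e
  | .inr _ => ⊤

instance {E F : Type} {Ω : E → Type} [i : ∀ e, MeasurableSpace (Ω e)]
    [j : ∀ e, MeasurableSingletonClass (Ω e)] (e : E ⊕ F) :
    MeasurableSingletonClass (Sum.elim Ω (fun _ => Unit) e) :=
  match e with
  | .inl e => j e
  | .inr _ => ⟨fun _ => trivial⟩

instance {E F : Type} {Ω : E → Type} [i : ∀ e, Finite (Ω e)] (e : E ⊕ F) :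
    Finite (Sum.elim Ω (fun _ => Unit) e) :=
  match e with
  | .inl e => i e
  | .inr _ => inferInstanceAs (Finite Unit)

/-- The laws of the unobserved variables of a model, together with trivial ones. -/
noncomputable def sumLaw {E F : Type} {Ω : E → Type} [∀ e, MeasurableSpace (Ω e)]
    (law : ∀ e, Measure (Ω e)) : ∀ e : E ⊕ F, Measure (Sum.elim Ω (fun _ => Unit) e)
  | .inl e => law e
  | .inr _ => Measure.dirac (α := Unit) ()

instance {E F : Type} {Ω : E → Type} [∀ e, MeasurableSpace (Ω e)] (law : ∀ e, Measure (Ω e))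
    [i : ∀ e, IsProbabilityMeasure (law e)] (e : E ⊕ F) : IsProbabilityMeasure (sumLaw law e) :=
  match e with
  | .inl e => i e
  | .inr _ => inferInstanceAs (IsProbabilityMeasure (Measure.dirac (α := Unit) ()))

theorem measurePreserving_sumLaw {E F : Type} [Fintype E] [Fintype F] {Ω : E → Type}
    [∀ e, MeasurableSpace (Ω e)] (law : ∀ e, Measure (Ω e)) [∀ e, IsProbabilityMeasure (law e)] :
    MeasurePreserving (fun (u : ∀ e : E ⊕ F, Sum.elim Ω (fun _ => Unit) e) =>
      (fun e => u (.inl e) : ∀ e, Ω e)) (Measure.pi (sumLaw law)) (Measure.pi law) :=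
  measurePreserving_comp_inl (sumLaw law)

instance (M : CausalModel V D') (e : M.U) : Nonempty (M.Ω e) :=
  (M.law e).nonempty_of_neZero

/-- By induction along `G`, each vertex of `Z` holds the right values of everything that can reach
it. The observed vertices then satisfy the equations of `M`, also under interventions. -/
theorem eq_solution_intervene_of_transmitted [Finite V] [∀ v, Nonempty (D v)]
    (M : CausalModel {v // v ∉ Z} D) {C : Type} (get : C → (∀ v, D v) × (∀ e, M.Ω e))
    (put : (∀ v, D v) × (∀ e, M.Ω e) → C) (apex : M.U → Set V) (hM : M.Induces (G.latentProjection Z))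
    (hput : ∀ c, get (put c) = c)
    (hapex : ∀ e v, e ∈ M.paU v → ∃ w ∈ apex e, G.LatentAnc Zᶜ w v) {X : Set V}
    {x a : ∀ v, LiftDom D C v} {u : ∀ e, M.Ω e} (hX : ∀ v ∈ X, a v = x v)
    (hZ : ∀ z (h : z ∈ Z), a z = (liftDomLatent D C h).symm
      (put (transmitted G get z a, transmittedExo G get apex z a u)))
    (hO : ∀ v : {v // v ∉ Z}, v.1 ∉ X → a v = (liftDomObserved D C v).symm
      (M.f v (transmitted G get v a) (transmittedExo G get apex v a u))) :
    (fun v : {v // v ∉ Z} => liftDomObserved D C v (a v)) =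
      (M.intervene {v | v.1 ∈ X} fun v => liftDomObserved D C v (x v)).solution u := by
  have hZ' : ∀ z (h : z ∈ Z), (∀ b : {v // v ∉ Z}, (∃ w, G.edge b w ∧ G.LatentAnc Zᶜ w z) →
      (get (liftDomLatent D C h (a z))).1 b = liftDomObserved D C b (a b)) ∧
      ∀ e, (∃ w ∈ apex e, G.LatentAnc Zᶜ w z) → (get (liftDomLatent D C h (a z))).2 e = u e := by
    intro z
    induction z using G.wellFounded_edge.induction with
    | _ z ih =>
    intro h
    rw [hZ z h, Equiv.apply_symm_apply, hput]
    exact ⟨fun b hb => transmitted_eq hb fun z' h' hz' hb' => (ih z' hz' h').1 b hb',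
      fun e he => transmittedExo_eq he fun z' h' hz' he' => (ih z' hz' h').2 e he'⟩
  refine M.eq_solution_intervene (fun v hv => ?_) fun v hv => ?_
  · rw [hX v hv]
  · rw [hO v hv, Equiv.apply_symm_apply]
    refine M.f_congr _ _ _ _ _ (fun b hb => ?_) fun e he => ?_
    · exact transmitted_eq (SMG.latentProjection_edge.1 ((hM.1 b v).2 hb))
        fun z h _ hb => (hZ' z h).1 b hb
    · exact transmittedExo_eq (hapex e v he) fun z h _ he => (hZ' z h).2 e he

open Classical in
/-- The model of `G` that simulates a model `M` of a latent projection of `G`: the variables in `Z`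
transmit the values of the observed variables and of the unobserved variables of `M`. -/
noncomputable def lift [Finite V] [∀ v, Nonempty (D v)] (M : CausalModel {v // v ∉ Z} D)
    [∀ e, Finite (M.Ω e)] [∀ e, MeasurableSingletonClass (M.Ω e)] {C : Type}
    (get : C → (∀ v, D v) × (∀ e, M.Ω e)) (put : (∀ v, D v) × (∀ e, M.Ω e) → C)
    (apex : M.U → Set V) (hcard : ∀ e, (apex e).encard ≤ 2) :
    CausalModel V (LiftDom D C) where
  -- The added one-valued variables carry no information; they realise the bidirected edges of `G`
  -- that the placement of `M.U` leaves unused.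
  U := M.U ⊕ G.bidirected.edgeSet
  fintypeU := letI := Fintype.ofFinite G.bidirected.edgeSet; inferInstance
  Ω := Sum.elim M.Ω fun _ => Unit
  law := sumLaw M.law
  paV v := {w | G.edge w v}
  paU v := {e | Sum.elim (fun e => v ∈ apex e) (fun b => v ∈ (b : Sym2 V)) e}
  f v a u :=
    if h : v ∈ Z then (liftDomLatent D C h).symm (put (transmitted G get v a,
      transmittedExo G get apex v a fun e => u (.inl e)))
    else (liftDomObserved D C ⟨v, h⟩).symm (M.f ⟨v, h⟩ (transmitted G get v a)
      (transmittedExo G get apex v a fun e => u (.inl e)))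
  f_congr v a a' u u' ha hu := by
    rw [transmitted_congr get ha, transmittedExo_congr get apex ha fun e he => hu (.inl e) he]
  -- Finiteness of the unobserved domains enters here.
  measurable_f v a := fun _ _ => (Set.toFinite _).measurableSet
  acyclic := G.acyclic
  card_children e := by
    rcases e with e | ⟨b, hb⟩
    · exact hcard e
    · induction b with
      | _ p q =>
      refine (Set.encard_le_encard (t := {p, q}) fun v hv => ?_).trans ?_
      · have hv : v ∈ s(p, q) := hv
        simpa using hv
      refine (Set.encard_insert_le _ _).trans ?_
      rw [Set.encard_singleton]; norm_num

section lift

variable [Finite V] [∀ v, Nonempty (D v)] (M : CausalModel {v // v ∉ Z} D)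
  [∀ e, Finite (M.Ω e)] [∀ e, MeasurableSingletonClass (M.Ω e)] {C : Type}
  (get : C → (∀ v, D v) × (∀ e, M.Ω e)) (put : (∀ v, D v) × (∀ e, M.Ω e) → C)
  (apex : M.U → Set V) (hcard : ∀ e, (apex e).encard ≤ 2)

theorem induces_lift (hadj : ∀ e, ∀ a ∈ apex e, ∀ b ∈ apex e, a ≠ b → G.bidirected.Adj a b) :
    (M.lift (G := G) get put apex hcard).Induces G := by
  refine ⟨fun a b => Iff.rfl, fun a b => ⟨fun hab => ⟨hab.ne, .inr ⟨s(a, b), hab⟩, ?_, ?_⟩, ?_⟩⟩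
  · exact Sym2.mem_mk_left a b
  · exact Sym2.mem_mk_right a b
  · rintro ⟨hne, e | ⟨s, hs⟩, ha, hb⟩
    · exact hadj e a ha b hb hne
    · have ha : a ∈ s := ha
      have hb : b ∈ s := hb
      obtain rfl := (Sym2.mem_and_mem_iff hne).1 ⟨ha, hb⟩
      exact hs

theorem causalEffect_lift [∀ v, Finite (D v)] [Nonempty C] (hM : M.Induces (G.latentProjection Z))
    (hput : ∀ c, get (put c) = c)
    (hapex : ∀ e v, e ∈ M.paU v → ∃ w ∈ apex e, G.LatentAnc Zᶜ w v) {X Y : Set V}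
    (hXZ : Disjoint X Z) (hYZ : Disjoint Y Z) (x y : ∀ v, LiftDom D C v) :
    (M.lift (G := G) get put apex hcard).causalEffect X x Y y =
      M.causalEffect {v | v.1 ∈ X} (fun v => liftDomObserved D C v (x v)) {v | v.1 ∈ Y}
        (fun v => liftDomObserved D C v (y v)) := by
  let _ := Fintype.ofFinite G.bidirected.edgeSet
  let L := M.lift (G := G) get put apex hcard
  have hsol : ∀ u : ∀ e : M.U ⊕ G.bidirected.edgeSet, Sum.elim M.Ω (fun _ => Unit) e,
      (fun v : {v // v ∉ Z} => liftDomObserved D C v ((L.intervene X x).solution u v)) =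
        (M.intervene {v | v.1 ∈ X} fun v => liftDomObserved D C v (x v)).solution
          fun e => u (.inl e) := by
    intro u
    refine M.eq_solution_intervene_of_transmitted get put apex hM hput hapex
      (fun v hv => L.solution_intervene_of_mem x u hv) (fun z h => ?_) fun v hv => ?_
    · exact (L.solution_intervene_of_notMem x u (Set.disjoint_right.1 hXZ h)).trans (dif_pos h)
    · exact (L.solution_intervene_of_notMem x u hv).trans (dif_neg v.2)
  have hset : {u : ∀ e, L.Ω e | ∀ v ∈ Y, (L.intervene X x).solution u v = y v} =
      (fun (u : ∀ e : M.U ⊕ G.bidirected.edgeSet, Sum.elim M.Ω (fun _ => Unit) e) =>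
        (fun e => u (.inl e) : ∀ e, M.Ω e)) ⁻¹' {u | ∀ v ∈ {v : {v // v ∉ Z} | v.1 ∈ Y},
          (M.intervene {v | v.1 ∈ X} fun v => liftDomObserved D C v (x v)).solution u v =
            liftDomObserved D C v (y v)} := by
    ext u
    constructor
    · exact fun h v hv => (congrFun (hsol u) v).symm.trans (congrArg _ (h v hv))
    · exact fun h v hv => (liftDomObserved D C ⟨v, Set.disjoint_left.1 hYZ hv⟩).injective
        ((congrFun (hsol u) _).trans (h ⟨v, Set.disjoint_left.1 hYZ hv⟩ hv))
  rw [causalEffect_eq, causalEffect_eq]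
  refine (congrArg _ hset).trans ?_
  exact (measurePreserving_sumLaw M.law).measure_preimage
    (Set.toFinite _).measurableSet.nullMeasurableSet

end lift

end CausalModel

namespace CausalModel

variable {V : Type} [Finite V]

theorem prob_eq_causalEffect_empty {D : V → Type} [∀ v, Nonempty (D v)] (M : CausalModel V D)
    (S : Set V) (x s : ∀ v, D v) : M.prob S s = M.causalEffect ∅ x S s := by
  have h : ∀ u, M.solution u = (M.intervene ∅ x).solution u := fun u =>
    M.eq_solution_intervene (by simp) fun v _ => M.solution_spec u v
  rw [causalEffect_eq, prob]
  simp only [h]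

theorem exists_liftDom_eq {V : Type} {Z : Set V} {D : {v // v ∉ Z} → Type} {C : Type} [Nonempty C]
    (x : ∀ v, D v) : ∃ x' : ∀ v, LiftDom D C v, ∀ v, liftDomObserved D C v (x' v) = x v := by
  classical
  refine ⟨fun v => if h : v ∈ Z then (liftDomLatent D C h).symm (Classical.arbitrary C)
    else (liftDomObserved D C ⟨v, h⟩).symm (x ⟨v, h⟩), fun v => ?_⟩
  dsimp only
  rw [dif_neg v.2, Equiv.apply_symm_apply]

/-- A model with finitely many values of the unobserved variables that induces a latent projection
of `G` can be simulated by a model that induces `G`. -/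
theorem exists_lift {G : SMG V} {Z : Set V} {D : {v // v ∉ Z} → Type} [∀ v, Finite (D v)]
    [∀ v, Nonempty (D v)] (M : CausalModel {v // v ∉ Z} D) [∀ e, Finite (M.Ω e)]
    [∀ e, MeasurableSingletonClass (M.Ω e)] {C : Type} [Nonempty C]
    (hM : M.Induces (G.latentProjection Z)) (get : C → (∀ v, D v) × (∀ e, M.Ω e))
    (put : (∀ v, D v) × (∀ e, M.Ω e) → C) (hput : ∀ c, get (put c) = c) :
    ∃ L : CausalModel V (LiftDom D C), L.Induces G ∧
      (∀ o, L.prob Zᶜ o = M.prob Set.univ fun v => liftDomObserved D C v (o v)) ∧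
      ∀ X Y, Disjoint X Z → Disjoint Y Z → ∀ x y, L.causalEffect X x Y y =
        M.causalEffect {v | v.1 ∈ X} (fun v => liftDomObserved D C v (x v)) {v | v.1 ∈ Y}
          (fun v => liftDomObserved D C v (y v)) := by
  choose apex hcard hadj hapex using M.exists_apex hM
  refine ⟨M.lift get put apex hcard, M.induces_lift get put apex hcard hadj, fun o => ?_,
    fun X Y hX hY x y => M.causalEffect_lift get put apex hcard hM hput hapex hX hY x y⟩
  rw [prob_eq_causalEffect_empty _ _ o, M.causalEffect_lift get put apex hcard hM hput hapex
    (by simp) disjoint_compl_left, 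
    M.prob_eq_causalEffect_empty _ fun v => liftDomObserved D C v (o v)]
  congr 1
  exact Set.eq_univ_of_forall fun v => v.2

end CausalModel

/-! ### Conclusion -/

theorem SMG.Hedge.not_identifiable_compl {V : Type} [Finite V] {G : SMG V} {X Y Z : Set V}
    (hXZ : Disjoint X Z) (hYZ : Disjoint Y Z)
    (h : (G.latentProjection Z).Hedge {v | v.1 ∈ X} {v | v.1 ∈ Y}) :
    ¬ G.Identifiable Zᶜ X Y := by
  obtain ⟨M₁, M₂, ⟨⟨h₁, hf₁, hm₁⟩, h₂, hf₂, hm₂⟩, hP, hpos, x, y, hne⟩ := h.exists_models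
  -- The two simulating models must have the same domains, so a value in `Z` has room for the
  -- unobserved values of both; each model fills the slot of the other arbitrarily.
  let C := ((({v // v ∉ Z}) → ZMod 2 × ZMod 2) × (∀ e, M₁.Ω e)) × (∀ e, M₂.Ω e)
  obtain ⟨L₁, hL₁, hp₁, he₁⟩ := M₁.exists_lift (C := C) h₁ (fun c => c.1)
    (fun c => (c, Classical.arbitrary _)) fun _ => rfl
  obtain ⟨L₂, hL₂, hp₂, he₂⟩ := M₂.exists_lift (C := C) h₂ (fun c => (c.1.1, c.2))
    (fun c => ((c.1, Classical.arbitrary _), c.2)) fun _ => rfl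
  obtain ⟨x', hx⟩ := CausalModel.exists_liftDom_eq (C := C) x
  obtain ⟨y', hy⟩ := CausalModel.exists_liftDom_eq (C := C) y
  intro hI
  have := hI _ L₁ L₂ hL₁ hL₂ (fun o => by rw [hp₁, hp₂, hP]) (fun o => by rw [hp₁]; exact hpos _)
    x' y'
  rw [he₁ X Y hXZ hYZ, he₂ X Y hXZ hYZ] at this
  simp only [hx, hy] at this
  exact hne this

theorem mainTheorem6 {V : Type} [Finite V] (G : SMG V) (X Y Z : Set V)
    (hXY : Disjoint X Y) (hXZ : Disjoint X Z) (hYZ : Disjoint Y Z) :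
    (G.latentProjection Z).Identifiable Set.univ {v | v.1 ∈ X} {v | v.1 ∈ Y} ↔
      G.Identifiable Zᶜ X Y := by
  constructor
  · exact fun hI => G.identifiable_compl_of_isEmpty_hedge hXY hXZ hYZ
      ⟨fun h => h.not_identifiable hI⟩
  · exact fun hI => (G.latentProjection Z).identifiable_of_isEmpty_hedge
      (Set.disjoint_left.2 fun _ hv hv' => Set.disjoint_left.1 hXY hv hv')
      ⟨fun h => h.not_identifiable_compl hXZ hYZ hI⟩
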